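/- **Parameters.** Fix an integer $\Delta\ge 5$, numbers $\gamma_5,\dots,\gamma_\Delta\in(0,1)$, $\lambda_{1,r}\in(0,1)$ for $3\le r\le 7$, $\lambda_{2,r}\in(0,1)$ for $3\le r\le 4$, $\lambda_3\in(0,1)$, and $\delta_{r,1},\delta_{r,2},\delta_{r,3}\ge 0$ with $\delta_{r,1}+\delta_{r,2}+\delta_{r,3}=1$ for $r\in\{5,6,7\}$. **Algorithm BetterVC.** The input is a finite simple graph $G=(V,E)$. Here $N(v)$ is the set of neighbours of $v$ and $G\setminus U$ is $G$ with the vertices of $U$ deleted. "Select $U$" means: return $\mathrm{BetterVC}(G\setminus U)\cup U$. "Branch over $U_1,\dots,U_m$ with probabilities $p_1,\dots,p_m$" means: with probability $p_i$ return $\mathrm{BetterVC}(G\setminus U_i)\cup U_i$. Different recursive calls use independent randomness. The first applicable rule is executed: 1. If $\emptyset$ is a vertex cover of $G$, return $\emptyset$. 2. If $G$ is not connected, let $G'$ be a connected component and $G''=G-G'$; return $\mathrm{BetterVC}(G')\cup\mathrm{BetterVC}(G'')$. 3. If some vertex has degree $1$, select its neighbour. 4. If some vertex $v$ has degree $d\ge5$: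 if $d<\Delta$, branch over $\{v\},N(v)$ with probabilities $\gamma_d,1-\gamma_d$; if $d\ge\Delta$, choose $U\subseteq N(v)$ with $|U|=\Delta$ and branch over $\{v\},U$ with probabilities $\gamma_\Delta,1-\gamma_\Delta$. 5. If $G$ is regular, take an edge $v_1v_2$, compute $S_i=\mathrm{BetterVC}(G\setminus\{v_i\})\cup\{v_i\}$ for $i=1,2$, and return the smaller of $S_1,S_2$. 6. If some vertex $v$ has degree $2$, $N(v)=\{x,y\}$: (a) if $xy\in E$, select $\{x,y\}$; (b) otherwise, if $\deg x=\deg y=2$ and $N(x)=N(y)=\{z,v\}$, select $\{z,v\}$; (c) otherwise, with $r=|N(x)\cup N(y)|$, branch over $N(v),\ N(x)\cup N(y)$ with probabilities $\lambda_{1,r},1-\lambda_{1,r}$. 7. Otherwise take a vertex $v$ of degree $3$ to which one of the following applies for some naming $N(v)=\{x,y,z\}$, the earlier ones not applying to $v$ for any naming: (a) $xy\in E$: with $r=|N(z)|$, branch over $N(v),N(z)$ with probabilities $\lambda_{2,r},1-\lambda_{2,r}$; (b) there is $w\notin N(v)\cup\{v\}$ with $x,y\in N(w)$: branch over $N(v),\{v,w\}$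 with probabilities $\lambda_3,1-\lambda_3$; (c) $\deg x=4$: with $r=|N(y)\cup N(z)|$, branch over $N(v),\ N(x),\ \{x\}\cup N(y)\cup N(z)$ with probabilities $\delta_{r,1},\delta_{r,2},\delta_{r,3}$. Choices left open (component, vertex, the set $U$, edge, naming of neighbours) are arbitrary and may be made differently in each call. **Recurrence.** Define $p:\mathbb Z\times\mathbb Z\to\mathbb R$ by $p(b,k)=0$ for $b<0$, $p(b,k)=1$ for $b\ge0$, $k\le0$, and, for $b\ge0$ and $k\ge1$, let $p(b,k)$ be the minimum of all of the following terms whose side condition holds: - $p(b-1,k-1)$; - $p(b-2,k-2)$, if $k\ge2$; - $\gamma_d\,p(b-1,k-1)+(1-\gamma_d)\,p(b-d,k-1)$, for $5\le d<\Delta$; - $\gamma_d\,p(b-1,k)+(1-\gamma_d)\,p(b-d,k-d)$, for $5\le d\le\Delta$, $k\ge d$; - $\gamma_\Delta\,p(b-1,k-1)+(1-\gamma_\Delta)\,p(b-\Delta,k)$; - $\lambda_{1,r}\,p(b-2,k-2)+(1-\lambda_{1,r})\,p(b-r,k-2)$, for $3\le r\le7$, $k\ge2$; - $\lambda_{1,r}\,p(b-2,k-1)+(1-\lambda_{1,r})\,p(b-r,k-r)$,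 for $3\le r\le7$, $k\ge r$; - $\lambda_{2,r}\,p(b-3,k-3)+(1-\lambda_{2,r})\,p(b-r,k-1)$, for $3\le r\le4$, $k\ge3$; - $\lambda_{2,r}\,p(b-3,k-1)+(1-\lambda_{2,r})\,p(b-r,k-r)$, for $3\le r\le4$, $k\ge r$; - $\lambda_3\,p(b-3,k-3)+(1-\lambda_3)\,p(b-2,k)$, if $k\ge3$; - $\lambda_3\,p(b-3,k-1)+(1-\lambda_3)\,p(b-2,k-2)$, if $k\ge2$; - $\delta_{r,1}\,p(b-3,k-3)+\delta_{r,2}\,p(b-4,k-1)+\delta_{r,3}\,p(b-r-1,k-3)$, for $5\le r\le7$, $k\ge4$; - $\delta_{r,1}\,p(b-3,k-1)+\delta_{r,2}\,p(b-4,k-4)+\delta_{r,3}\,p(b-r-1,k-r)$, for $5\le r\le7$, $k\ge r$; - $\delta_{r,1}\,p(b-3,k-2)+\delta_{r,2}\,p(b-4,k-4)+\delta_{r,3}\,p(b-r-1,k-1-\lceil r/2\rceil)$, for $5\le r\le7$, $k\ge1+\lceil r/2\rceil$; - $\delta_{r,1}\,p(b-3,k-2)+\delta_{r,2}\,p(b-4,k-2)+\delta_{r,3}\,p(b-r-1,k-r-1)$,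 for $5\le r\le7$, $k\ge r-1$. **Lemma.** Let $k\in\mathbb N$, let $G$ be a finite simple graph that has a vertex cover of size at most $k$, and let $b\in\mathbb Z$. Then BetterVC is well defined on $G$ (there is at least one way to make the open choices for which it runs to completion), and, however the open choices are made, the probability that $\mathrm{BetterVC}(G)$ returns a vertex cover of $G$ of size at most $b$ is at least $p(b,k)$. -/

import Mathlib

namespace BetterVC

/-! ### Configuration parameters -/

/-- The configuration parameters. Each family is a function on `ℕ`, constrained only on the
indices at which it is used. -/
structure Params where
  Delta : ℕ
  gam : ℕ → ℝ
  lam1 : ℕ → ℝ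
  lam2 : ℕ → ℝ
  lam3 : ℝ
  del1 : ℕ → ℝ
  del2 : ℕ → ℝ
  del3 : ℕ → ℝ
  five_le_Delta : 5 ≤ Delta
  gam_mem : ∀ d, 5 ≤ d → d ≤ Delta → gam d ∈ Set.Ioo (0 : ℝ) 1
  lam1_mem : ∀ r, 3 ≤ r → r ≤ 7 → lam1 r ∈ Set.Ioo (0 : ℝ) 1
  lam2_mem : ∀ r, 3 ≤ r → r ≤ 4 → lam2 r ∈ Set.Ioo (0 : ℝ) 1
  lam3_mem : lam3 ∈ Set.Ioo (0 : ℝ) 1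
  del1_nonneg : ∀ r, 5 ≤ r → r ≤ 7 → 0 ≤ del1 r
  del2_nonneg : ∀ r, 5 ≤ r → r ≤ 7 → 0 ≤ del2 r
  del3_nonneg : ∀ r, 5 ≤ r → r ≤ 7 → 0 ≤ del3 r
  del_sum : ∀ r, 5 ≤ r → r ≤ 7 → del1 r + del2 r + del3 r = 1

/-! ### The recurrence -/

/-- `Term P p b k t`: the number `t` is one of the terms over which the minimum defining
`p(b,k)` is taken, for `b ≥ 0` and `k ≥ 1`. -/
inductive Term (P : Params) (p : ℤ → ℤ → ℝ) (b k : ℤ) : ℝ → Prop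
  | one : Term P p b k (p (b - 1) (k - 1))
  | two : 2 ≤ k → Term P p b k (p (b - 2) (k - 2))
  | degIn (d : ℕ) : 5 ≤ d → d < P.Delta →
      Term P p b k (P.gam d * p (b - 1) (k - 1) + (1 - P.gam d) * p (b - d) (k - 1))
  | degOut (d : ℕ) : 5 ≤ d → d ≤ P.Delta → (d : ℤ) ≤ k →
      Term P p b k (P.gam d * p (b - 1) k + (1 - P.gam d) * p (b - d) (k - d))
  | degMax :
      Term P p b k
        (P.gam P.Delta * p (b - 1) (k - 1) + (1 - P.gam P.Delta) * p (b - P.Delta) k)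
  | lam1Out (r : ℕ) : 3 ≤ r → r ≤ 7 → 2 ≤ k →
      Term P p b k (P.lam1 r * p (b - 2) (k - 2) + (1 - P.lam1 r) * p (b - r) (k - 2))
  | lam1In (r : ℕ) : 3 ≤ r → r ≤ 7 → (r : ℤ) ≤ k →
      Term P p b k (P.lam1 r * p (b - 2) (k - 1) + (1 - P.lam1 r) * p (b - r) (k - r))
  | lam2Out (r : ℕ) : 3 ≤ r → r ≤ 4 → 3 ≤ k →
      Term P p b k (P.lam2 r * p (b - 3) (k - 3) + (1 - P.lam2 r) * p (b - r) (k - 1))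
  | lam2In (r : ℕ) : 3 ≤ r → r ≤ 4 → (r : ℤ) ≤ k →
      Term P p b k (P.lam2 r * p (b - 3) (k - 1) + (1 - P.lam2 r) * p (b - r) (k - r))
  | lam3Out : 3 ≤ k →
      Term P p b k (P.lam3 * p (b - 3) (k - 3) + (1 - P.lam3) * p (b - 2) k)
  | lam3In : 2 ≤ k →
      Term P p b k (P.lam3 * p (b - 3) (k - 1) + (1 - P.lam3) * p (b - 2) (k - 2))
  | del1 (r : ℕ) : 5 ≤ r → r ≤ 7 → 4 ≤ k →
      Term P p b k
        (P.del1 r * p (b - 3) (k - 3) + P.del2 r * p (b - 4) (k - 1)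
          + P.del3 r * p (b - r - 1) (k - 3))
  | del2 (r : ℕ) : 5 ≤ r → r ≤ 7 → (r : ℤ) ≤ k →
      Term P p b k
        (P.del1 r * p (b - 3) (k - 1) + P.del2 r * p (b - 4) (k - 4)
          + P.del3 r * p (b - r - 1) (k - r))
  | del3 (r : ℕ) : 5 ≤ r → r ≤ 7 → 1 + ⌈(r : ℚ) / 2⌉ ≤ k →
      Term P p b k
        (P.del1 r * p (b - 3) (k - 2) + P.del2 r * p (b - 4) (k - 4)
          + P.del3 r * p (b - r - 1) (k - 1 - ⌈(r : ℚ) / 2⌉))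
  | del4 (r : ℕ) : 5 ≤ r → r ≤ 7 → (r : ℤ) - 1 ≤ k →
      Term P p b k
        (P.del1 r * p (b - 3) (k - 2) + P.del2 r * p (b - 4) (k - 2)
          + P.del3 r * p (b - r - 1) (k - r - 1))

/-- The function `p(b,k)`. All terms refer to values of `p` at strictly smaller first argument,
so the guard `b' < b` only serves to make the recursion well founded; `prob_isLeast` below shows
that `prob` satisfies the recurrence itself. -/
noncomputable def prob (P : Params) (b k : ℤ) : ℝ :=
  if b < 0 then 0
  else if k ≤ 0 then 1
  else sInf {t | Term P (fun b' k' => if b' < b then prob P b' k' else 0) b k t}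
termination_by (b + 1).toNat
decreasing_by omega

theorem Term.congr {P : Params} {p q : ℤ → ℤ → ℝ} {b k : ℤ} {t : ℝ}
    (h : ∀ b' k', b' < b → p b' k' = q b' k') (ht : Term P p b k t) : Term P q b k t := by
  have hD := P.five_le_Delta
  cases ht with
  | one => rw [h _ _ (by omega)]; exact .one
  | two hk => rw [h _ _ (by omega)]; exact .two hk
  | degIn d h1 h2 => rw [h _ _ (by omega), h _ _ (by omega)]; exact .degIn d h1 h2
  | degOut d h1 h2 h3 => rw [h _ _ (by omega), h _ _ (by omega)]; exact .degOut d h1 h2 h3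
  | degMax => rw [h _ _ (by omega), h _ _ (by omega)]; exact .degMax
  | lam1Out r h1 h2 h3 => rw [h _ _ (by omega), h _ _ (by omega)]; exact .lam1Out r h1 h2 h3
  | lam1In r h1 h2 h3 => rw [h _ _ (by omega), h _ _ (by omega)]; exact .lam1In r h1 h2 h3
  | lam2Out r h1 h2 h3 => rw [h _ _ (by omega), h _ _ (by omega)]; exact .lam2Out r h1 h2 h3
  | lam2In r h1 h2 h3 => rw [h _ _ (by omega), h _ _ (by omega)]; exact .lam2In r h1 h2 h3
  | lam3Out h1 => rw [h _ _ (by omega), h _ _ (by omega)]; exact .lam3Out h1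
  | lam3In h1 => rw [h _ _ (by omega), h _ _ (by omega)]; exact .lam3In h1
  | del1 r h1 h2 h3 =>
    rw [h _ _ (by omega), h _ _ (by omega), h _ _ (by omega)]; exact .del1 r h1 h2 h3
  | del2 r h1 h2 h3 =>
    rw [h _ _ (by omega), h _ _ (by omega), h _ _ (by omega)]; exact .del2 r h1 h2 h3
  | del3 r h1 h2 h3 =>
    rw [h _ _ (by omega), h _ _ (by omega), h _ _ (by omega)]; exact .del3 r h1 h2 h3
  | del4 r h1 h2 h3 =>
    rw [h _ _ (by omega), h _ _ (by omega), h _ _ (by omega)]; exact .del4 r h1 h2 h3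

theorem Term.finite (P : Params) (p : ℤ → ℤ → ℝ) (b k : ℤ) : {t | Term P p b k t}.Finite := by
  -- A term is determined by its kind (15 of them) and an index at most `max Delta 7`.
  let f : Fin 15 × ℕ → ℝ := fun ij =>
    let r := ij.2
    ![p (b - 1) (k - 1),
      p (b - 2) (k - 2),
      P.gam r * p (b - 1) (k - 1) + (1 - P.gam r) * p (b - r) (k - 1),
      P.gam r * p (b - 1) k + (1 - P.gam r) * p (b - r) (k - r),
      P.gam P.Delta * p (b - 1) (k - 1) + (1 - P.gam P.Delta) * p (b - P.Delta) k,
      P.lam1 r * p (b - 2) (k - 2) + (1 - P.lam1 r) * p (b - r) (k - 2),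
      P.lam1 r * p (b - 2) (k - 1) + (1 - P.lam1 r) * p (b - r) (k - r),
      P.lam2 r * p (b - 3) (k - 3) + (1 - P.lam2 r) * p (b - r) (k - 1),
      P.lam2 r * p (b - 3) (k - 1) + (1 - P.lam2 r) * p (b - r) (k - r),
      P.lam3 * p (b - 3) (k - 3) + (1 - P.lam3) * p (b - 2) k,
      P.lam3 * p (b - 3) (k - 1) + (1 - P.lam3) * p (b - 2) (k - 2),
      P.del1 r * p (b - 3) (k - 3) + P.del2 r * p (b - 4) (k - 1)
        + P.del3 r * p (b - r - 1) (k - 3),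
      P.del1 r * p (b - 3) (k - 1) + P.del2 r * p (b - 4) (k - 4)
        + P.del3 r * p (b - r - 1) (k - r),
      P.del1 r * p (b - 3) (k - 2) + P.del2 r * p (b - 4) (k - 4)
        + P.del3 r * p (b - r - 1) (k - 1 - ⌈(r : ℚ) / 2⌉),
      P.del1 r * p (b - 3) (k - 2) + P.del2 r * p (b - 4) (k - 2)
        + P.del3 r * p (b - r - 1) (k - r - 1)] ij.1
  have hfin : (f '' (Set.univ ×ˢ Set.Iic (max P.Delta 7))).Finite :=
    (Set.finite_univ.prod (Set.finite_Iic _)).image f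
  refine hfin.subset ?_
  intro t ht
  have key : ∀ (i : Fin 15) (r : ℕ), r ≤ max P.Delta 7 →
      f (i, r) ∈ f '' (Set.univ ×ˢ Set.Iic (max P.Delta 7)) := fun i r hr =>
    ⟨(i, r), ⟨Set.mem_univ _, hr⟩, rfl⟩
  cases ht with
  | one => exact key 0 0 (by omega)
  | two _ => exact key 1 0 (by omega)
  | degIn d _ _ => exact key 2 d (by omega)
  | degOut d _ _ _ => exact key 3 d (by omega)
  | degMax => exact key 4 0 (by omega)
  | lam1Out r _ _ _ => exact key 5 r (by omega)
  | lam1In r _ _ _ => exact key 6 r (by omega)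
  | lam2Out r _ _ _ => exact key 7 r (by omega)
  | lam2In r _ _ _ => exact key 8 r (by omega)
  | lam3Out _ => exact key 9 0 (by omega)
  | lam3In _ => exact key 10 0 (by omega)
  | del1 r _ _ _ => exact key 11 r (by omega)
  | del2 r _ _ _ => exact key 12 r (by omega)
  | del3 r _ _ _ => exact key 13 r (by omega)
  | del4 r _ _ _ => exact key 14 r (by omega)

theorem prob_of_neg (P : Params) {b : ℤ} (hb : b < 0) (k : ℤ) : prob P b k = 0 := by
  rw [prob, if_pos hb]

theorem prob_of_nonpos (P : Params) {b k : ℤ} (hb : 0 ≤ b) (hk : k ≤ 0) : prob P b k = 1 := by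
  rw [prob, if_neg (not_lt.mpr hb), if_pos hk]

/-- `prob` satisfies the recurrence: for `b ≥ 0` and `k ≥ 1`, the value `p(b,k)` is the minimum
of the terms formed from `p` itself. -/
theorem prob_isLeast (P : Params) {b k : ℤ} (hb : 0 ≤ b) (hk : 1 ≤ k) :
    IsLeast {t | Term P (prob P) b k t} (prob P b k) := by
  have hset : {t | Term P (fun b' k' => if b' < b then prob P b' k' else 0) b k t}
      = {t | Term P (prob P) b k t} := by
    ext t
    exact ⟨fun h => Term.congr (fun b' k' hlt => by simp [hlt]) h,
      fun h => Term.congr (fun b' k' hlt => by simp [hlt]) h⟩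
  have hval : prob P b k = sInf {t | Term P (prob P) b k t} := by
    rw [prob, if_neg (not_lt.mpr hb), if_neg (by omega), hset]
  have hfin := Term.finite P (prob P) b k
  have hne : {t | Term P (prob P) b k t}.Nonempty := ⟨_, Term.one⟩
  rw [hval]
  exact ⟨hne.csInf_mem hfin, fun t ht => csInf_le hfin.bddBelow ht⟩

/-! ### The algorithm

Every graph on which the algorithm is called recursively is an induced subgraph of the input
graph. So `G` is a fixed graph and a call is described by its vertex set `A`; it stands for the
call on the graph `G.induce A`. -/

section Algorithm

variable {V : Type*} [DecidableEq V] (P : Params) (G : SimpleGraph V) [DecidableRel G.Adj]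

/-- The neighbourhood of `v` in the graph induced on `A`. -/
def nbr (A : Finset V) (v : V) : Finset V := {u ∈ A | G.Adj v u}

/-- The degree of `v` in the graph induced on `A`. -/
def deg (A : Finset V) (v : V) : ℕ := (nbr G A v).card

/-- `C` is the vertex set of a connected component of the graph induced on `A`. -/
def IsComponent (A C : Finset V) : Prop :=
  ∃ c : (G.induce (A : Set V)).ConnectedComponent, (C : Set V) = Subtype.val '' c.supp

/-- The empty set is a vertex cover of the graph induced on `A`. -/
def Trivial (A : Finset V) : Prop := (G.induce (A : Set V)).IsVertexCover ∅

/-- The graph induced on `A` is regular. -/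
def Regular (A : Finset V) : Prop := ∃ d, ∀ v ∈ A, deg G A v = d

/-- The first two instructions (empty cover, splitting) do not apply. -/
def PastSplit (A : Finset V) : Prop := ¬ Trivial G A ∧ (G.induce (A : Set V)).Connected

/-- In addition, there is no vertex of degree `1`. -/
def PastDegOne (A : Finset V) : Prop := PastSplit G A ∧ ∀ v ∈ A, deg G A v ≠ 1

/-- In addition, there is no vertex of degree `5` or more. -/
def PastHighDeg (A : Finset V) : Prop := PastDegOne G A ∧ ∀ v ∈ A, ¬ 5 ≤ deg G A v

/-- In addition, the graph is not regular. -/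
def PastRegular (A : Finset V) : Prop := PastHighDeg G A ∧ ¬ Regular G A

/-- In addition, there is no vertex of degree `2`. -/
def PastDegTwo (A : Finset V) : Prop := PastRegular G A ∧ ∀ v ∈ A, deg G A v ≠ 2

/-- The vertices `v, x, y, z` form the configuration of the second degree-two rule. -/
def Square (A : Finset V) (v x y z : V) : Prop :=
  deg G A x = 2 ∧ deg G A y = 2 ∧ nbr G A x = {z, v} ∧ nbr G A y = {z, v}

/-- Two neighbours of `v` are adjacent. -/
def HasTriangle (A : Finset V) (v : V) : Prop :=
  ∃ x ∈ nbr G A v, ∃ y ∈ nbr G A v, G.Adj x y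

/-- Two neighbours of `v` have a common neighbour outside the closed neighbourhood of `v`. -/
def HasCommon (A : Finset V) (v : V) : Prop :=
  ∃ x ∈ nbr G A v, ∃ y ∈ nbr G A v, x ≠ y ∧
    ∃ w ∈ A, w ∉ nbr G A v ∧ w ≠ v ∧ x ∈ nbr G A w ∧ y ∈ nbr G A w

/-- The kinds of operations the algorithm performs. -/
inductive Action (V : Type*)
  /-- return the empty set -/
  | done
  /-- return the union of the results on `B` and on `C` -/
  | split (B C : Finset V)
  /-- select `U` to the cover -/
  | select (U : Finset V)
  /-- branch over `U 0, ..., U (n - 1)` with probabilities `w 0, ..., w (n - 1)` -/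
  | branch (n : ℕ) (w : Fin n → ℝ) (U : Fin n → Finset V)
  /-- return the smaller of the two covers obtained by selecting `v₁` and by selecting `v₂` -/
  | best (v₁ v₂ : V)

/-- The code of the algorithm: `Step P G A a` says that `a` is an operation that the algorithm may
perform on the graph induced on `A`. There is one constructor per instruction (two for the
instruction on vertices of high degree); several operations are possible where the code leaves a
choice open (which component, which vertex, which edge, how the neighbours are named). -/
inductive Step (A : Finset V) : Action V → Prop
  | empty : Trivial G A → Step A .done
  | split (C : Finset V) :
      ¬ Trivial G A → ¬ (G.induce (A : Set V)).Connected → IsComponent G A C →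
      Step A (.split C (A \ C))
  | degOne (v u : V) : PastSplit G A → v ∈ A → nbr G A v = {u} →
      Step A (.select {u})
  | degHigh (v : V) : PastDegOne G A → v ∈ A → 5 ≤ deg G A v → deg G A v < P.Delta →
      Step A (.branch 2 ![P.gam (deg G A v), 1 - P.gam (deg G A v)] ![{v}, nbr G A v])
  | degVeryHigh (v : V) (U : Finset V) : PastDegOne G A → v ∈ A → 5 ≤ deg G A v →
      P.Delta ≤ deg G A v → U ⊆ nbr G A v → U.card = P.Delta →
      Step A (.branch 2 ![P.gam P.Delta, 1 - P.gam P.Delta] ![{v}, U])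
  | regular (v₁ v₂ : V) : PastHighDeg G A → Regular G A → v₁ ∈ A → v₂ ∈ A → G.Adj v₁ v₂ →
      Step A (.best v₁ v₂)
  | twoTriangle (v x y : V) : PastRegular G A → v ∈ A → deg G A v = 2 → nbr G A v = {x, y} →
      G.Adj x y →
      Step A (.select {x, y})
  | twoSquare (v x y z : V) : PastRegular G A → v ∈ A → deg G A v = 2 → nbr G A v = {x, y} →
      ¬ G.Adj x y → Square G A v x y z →
      Step A (.select {z, v})
  | twoOther (v x y : V) : PastRegular G A → v ∈ A → deg G A v = 2 → nbr G A v = {x, y} →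
      ¬ G.Adj x y → (∀ z, ¬ Square G A v x y z) →
      Step A (.branch 2
        ![P.lam1 (nbr G A x ∪ nbr G A y).card, 1 - P.lam1 (nbr G A x ∪ nbr G A y).card]
        ![nbr G A v, nbr G A x ∪ nbr G A y])
  | threeTriangle (v x y z : V) : PastDegTwo G A → v ∈ A → deg G A v = 3 →
      nbr G A v = {x, y, z} → G.Adj x y →
      Step A (.branch 2 ![P.lam2 (nbr G A z).card, 1 - P.lam2 (nbr G A z).card]
        ![nbr G A v, nbr G A z])
  | threeCommon (v x y z w : V) : PastDegTwo G A → v ∈ A → deg G A v = 3 →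
      nbr G A v = {x, y, z} → ¬ HasTriangle G A v →
      w ∈ A → w ∉ nbr G A v → w ≠ v → x ∈ nbr G A w → y ∈ nbr G A w →
      Step A (.branch 2 ![P.lam3, 1 - P.lam3] ![nbr G A v, {v, w}])
  | threeFour (v x y z : V) : PastDegTwo G A → v ∈ A → deg G A v = 3 →
      nbr G A v = {x, y, z} → ¬ HasTriangle G A v → ¬ HasCommon G A v → deg G A x = 4 →
      Step A (.branch 3
        ![P.del1 (nbr G A y ∪ nbr G A z).card, P.del2 (nbr G A y ∪ nbr G A z).card,
          P.del3 (nbr G A y ∪ nbr G A z).card]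
        ![nbr G A v, nbr G A x, {x} ∪ nbr G A y ∪ nbr G A z])

/-- The random choice of an index `i : Fin n` with probability `w i`. -/
noncomputable def choose {n : ℕ} (w : Fin n → ℝ) (hw : w ∈ stdSimplex ℝ (Fin n)) : PMF (Fin n) :=
  PMF.ofFintype (fun i => ENNReal.ofReal (w i)) (by
    rw [← ENNReal.ofReal_sum_of_nonneg (fun i _ => hw.1 i), hw.2, ENNReal.ofReal_one])

/-- `Run P G A μ`: the probability distribution `μ` is the law of the output of the algorithm on
the graph induced on `A`, for some resolution of the choices that the code leaves open.
Different recursive calls use independent randomness and may resolve open choices differently. -/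
inductive Run : Finset V → PMF (Finset V) → Prop
  | done {A : Finset V} : Step P G A .done → Run A (PMF.pure ∅)
  | split {A B C : Finset V} {μ ν : PMF (Finset V)} : Step P G A (.split B C) →
      Run B μ → Run C ν → Run A (μ.bind fun S => ν.map fun T => S ∪ T)
  | select {A U : Finset V} {μ : PMF (Finset V)} : Step P G A (.select U) →
      Run (A \ U) μ → Run A (μ.map fun S => S ∪ U)
  | branch {A : Finset V} {n : ℕ} {w : Fin n → ℝ} {U : Fin n → Finset V}
      (hw : w ∈ stdSimplex ℝ (Fin n)) (μ : Fin n → PMF (Finset V)) :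
      Step P G A (.branch n w U) → (∀ i, Run (A \ U i) (μ i)) →
      Run A ((choose w hw).bind fun i => (μ i).map fun S => S ∪ U i)
  | best {A : Finset V} {v₁ v₂ : V} {μ ν : PMF (Finset V)} : Step P G A (.best v₁ v₂) →
      Run (A \ {v₁}) μ → Run (A \ {v₂}) ν →
      Run A (μ.bind fun S => ν.map fun T =>
        if (S ∪ {v₁}).card ≤ (T ∪ {v₂}).card then S ∪ {v₁} else T ∪ {v₂})

end Algorithm

end BetterVC

namespace BetterVC

/-! ### Properties of the recurrence -/

section Recurrence

variable (P : Params)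

/-! The probability bound is a special case of an estimate that composes along recursive calls. If
the graph induced on `A` has a cover of size at most `k`, then for every `m ≥ 0` the random output
`S` satisfies p(b, k + m) ≤ E[p(b - |S|, m)] (`Run.prob_le_expect`). For `m = 0` the integrand is
the indicator of |S| ≤ b, and every possible output is a cover (`Run.covers`), so the right side is
the desired probability.

The extra `m` is what handles disconnected graphs. The components share one budget, and bounds for
the separate success probabilities would not combine into p(b, k). With `m`, the first component is
processed while the cover size of the second is still held in reserve, and then the second component
is processed with the budget that remains.

For the other rules, fix a small cover `C`, unknown to the algorithm. The way `C` meets the vertices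
involved determines by how much the required cover size drops in each branch, and each possibility
matches one term of the recurrence (`Step.select_bound`, `Step.branch_bound`, `Step.best_bound`).
Two facts make the list of possibilities short. A cover missing at most one neighbour of `v` can be
exchanged for one containing all of them, so otherwise `C` contains `v` and misses at least two
neighbours (`Covers.nbr_dichotomy`). After a deletion, `C` may also drop vertices that became
isolated (`Covers.hasCover_sdiff`). Losses from |S ∪ U| ≤ |S| + |U| are absorbed by monotonicity of
p (`prob_mono`).

Runs exist because every call is on a strictly smaller vertex set and some rule always applies. The
only delicate point is the last rule: a connected non-regular graph with all degrees 3 or 4 has an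
edge joining a vertex of degree 3 to one of degree 4. -/

theorem prob_le_of_term {b k : ℤ} {t : ℝ} (hb : 0 ≤ b) (hk : 1 ≤ k)
    (ht : Term P (prob P) b k t) : prob P b k ≤ t :=
  (prob_isLeast P hb hk).2 ht

theorem prob_le_one (b k : ℤ) : prob P b k ≤ 1 := by
  by_cases hb : b < 0
  · rw [prob_of_neg P hb]; exact zero_le_one
  · by_cases hk : k ≤ 0
    · rw [prob_of_nonpos P (not_lt.mp hb) hk]
    · exact (prob_le_of_term P (not_lt.mp hb) (by omega) .one).trans (prob_le_one (b - 1) (k - 1))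
termination_by (b + 1).toNat
decreasing_by omega

theorem Params.gam_bounds {d : ℕ} (h : 5 ≤ d) (h' : d ≤ P.Delta) :
    0 ≤ P.gam d ∧ 0 ≤ 1 - P.gam d :=
  ⟨(P.gam_mem d h h').1.le, sub_nonneg.2 (P.gam_mem d h h').2.le⟩

theorem Params.lam1_bounds {r : ℕ} (h : 3 ≤ r) (h' : r ≤ 7) :
    0 ≤ P.lam1 r ∧ 0 ≤ 1 - P.lam1 r :=
  ⟨(P.lam1_mem r h h').1.le, sub_nonneg.2 (P.lam1_mem r h h').2.le⟩

theorem Params.lam2_bounds {r : ℕ} (h : 3 ≤ r) (h' : r ≤ 4) :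
    0 ≤ P.lam2 r ∧ 0 ≤ 1 - P.lam2 r :=
  ⟨(P.lam2_mem r h h').1.le, sub_nonneg.2 (P.lam2_mem r h h').2.le⟩

theorem Params.lam3_bounds : 0 ≤ P.lam3 ∧ 0 ≤ 1 - P.lam3 :=
  ⟨P.lam3_mem.1.le, sub_nonneg.2 P.lam3_mem.2.le⟩

/-- Moving to arguments `b'`, `k'` with `k ≤ k'` turns each term into a term of the same kind;
if the values of `p` decrease along the move, so does the term. -/
theorem Term.exists_le {p : ℤ → ℤ → ℝ} {b b' k k' : ℤ} {t : ℝ} (hkk : k ≤ k')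
    (h : ∀ c j : ℤ, 1 ≤ c → p (b' - c) (k' - j) ≤ p (b - c) (k - j)) (ht : Term P p b k t) :
    ∃ t', Term P p b' k' t' ∧ t' ≤ t := by
  have h0 : ∀ c : ℤ, 1 ≤ c → p (b' - c) k' ≤ p (b - c) k := fun c hc => by
    simpa using h c 0 hc
  have hD := P.five_le_Delta
  have two : ∀ {x y a a' c c' : ℝ}, 0 ≤ x ∧ 0 ≤ y → a ≤ a' → c ≤ c' →
      x * a + y * c ≤ x * a' + y * c' := fun hxy h1 h2 =>
    add_le_add (mul_le_mul_of_nonneg_left h1 hxy.1) (mul_le_mul_of_nonneg_left h2 hxy.2)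
  have three : ∀ (r : ℕ) {a a' c c' e e' : ℝ}, 5 ≤ r → r ≤ 7 → a ≤ a' → c ≤ c' → e ≤ e' →
      P.del1 r * a + P.del2 r * c + P.del3 r * e ≤
        P.del1 r * a' + P.del2 r * c' + P.del3 r * e' := fun r _ _ _ _ _ _ h5 h7 h1 h2 h3 =>
    add_le_add (add_le_add (mul_le_mul_of_nonneg_left h1 (P.del1_nonneg r h5 h7))
      (mul_le_mul_of_nonneg_left h2 (P.del2_nonneg r h5 h7)))
      (mul_le_mul_of_nonneg_left h3 (P.del3_nonneg r h5 h7))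
  -- The third branch of the last rule costs `r + 1`, which `Term` writes as two successive
  -- subtractions.
  have h1 : ∀ r j : ℤ, 0 ≤ r → p (b' - r - 1) (k' - j) ≤ p (b - r - 1) (k - j) :=
    fun r j hr => by simpa [sub_sub] using h (r + 1) j (by omega)
  have h2 : ∀ r j : ℤ, 0 ≤ r → ∀ i : ℤ,
      p (b' - r - 1) (k' - j - i) ≤ p (b - r - 1) (k - j - i) :=
    fun r j hr i => by simpa [sub_sub] using h (r + 1) (j + i) (by omega)
  cases ht with
  | one => exact ⟨_, .one, h _ _ le_rfl⟩
  | two hk => exact ⟨_, .two (by omega), h _ _ (by omega)⟩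
  | degIn d h5 hd =>
    exact ⟨_, .degIn d h5 hd, two (P.gam_bounds h5 hd.le) (h _ _ le_rfl) (h _ _ (by omega))⟩
  | degOut d h5 hd hk =>
    exact ⟨_, .degOut d h5 hd (by omega), two (P.gam_bounds h5 hd) (h0 _ le_rfl) (h _ _ (by omega))⟩
  | degMax =>
    exact ⟨_, .degMax, two (P.gam_bounds hD le_rfl) (h _ _ le_rfl) (h0 _ (by omega))⟩
  | lam1Out r h3 h7 hk =>
    exact ⟨_, .lam1Out r h3 h7 (by omega),
      two (P.lam1_bounds h3 h7) (h _ _ (by omega)) (h _ _ (by omega))⟩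
  | lam1In r h3 h7 hk =>
    exact ⟨_, .lam1In r h3 h7 (by omega),
      two (P.lam1_bounds h3 h7) (h _ _ (by omega)) (h _ _ (by omega))⟩
  | lam2Out r h3 h4 hk =>
    exact ⟨_, .lam2Out r h3 h4 (by omega),
      two (P.lam2_bounds h3 h4) (h _ _ (by omega)) (h _ _ (by omega))⟩
  | lam2In r h3 h4 hk =>
    exact ⟨_, .lam2In r h3 h4 (by omega),
      two (P.lam2_bounds h3 h4) (h _ _ (by omega)) (h _ _ (by omega))⟩
  | lam3Out hk =>
    exact ⟨_, .lam3Out (by omega), two P.lam3_bounds (h _ _ (by omega)) (h0 _ (by omega))⟩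
  | lam3In hk =>
    exact ⟨_, .lam3In (by omega), two P.lam3_bounds (h _ _ (by omega)) (h _ _ (by omega))⟩
  | del1 r h5 h7 hk =>
    exact ⟨_, .del1 r h5 h7 (by omega),
      three r h5 h7 (h _ _ (by omega)) (h _ _ (by omega)) (h1 _ _ (by omega))⟩
  | del2 r h5 h7 hk =>
    exact ⟨_, .del2 r h5 h7 (by omega),
      three r h5 h7 (h _ _ (by omega)) (h _ _ (by omega)) (h1 _ _ (by omega))⟩
  | del3 r h5 h7 hk =>
    exact ⟨_, .del3 r h5 h7 (by omega),
      three r h5 h7 (h _ _ (by omega)) (h _ _ (by omega)) (h2 _ _ (by omega) _)⟩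
  | del4 r h5 h7 hk =>
    exact ⟨_, .del4 r h5 h7 (by omega),
      three r h5 h7 (h _ _ (by omega)) (h _ _ (by omega)) (h2 _ _ (by omega) _)⟩

theorem prob_nonneg (b k : ℤ) : 0 ≤ prob P b k := by
  by_cases hb : b < 0
  · rw [prob_of_neg P hb]
  · by_cases hk : k ≤ 0
    · rw [prob_of_nonpos P (not_lt.mp hb) hk]; exact zero_le_one
    · have hD := P.five_le_Delta
      have two : ∀ {x y a c : ℝ}, 0 ≤ x ∧ 0 ≤ y → 0 ≤ a → 0 ≤ c → 0 ≤ x * a + y * c :=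
        fun hxy h1 h2 => add_nonneg (mul_nonneg hxy.1 h1) (mul_nonneg hxy.2 h2)
      have three : ∀ (r : ℕ) {a c e : ℝ}, 5 ≤ r → r ≤ 7 → 0 ≤ a → 0 ≤ c → 0 ≤ e →
          0 ≤ P.del1 r * a + P.del2 r * c + P.del3 r * e := fun r _ _ _ h5 h7 h1 h2 h3 =>
        add_nonneg (add_nonneg (mul_nonneg (P.del1_nonneg r h5 h7) h1)
          (mul_nonneg (P.del2_nonneg r h5 h7) h2)) (mul_nonneg (P.del3_nonneg r h5 h7) h3)
      have key : ∀ c j : ℤ, c < b → 0 ≤ prob P c j := fun c j hc => prob_nonneg c j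
      have ht := (prob_isLeast P (not_lt.mp hb) (show 1 ≤ k by omega)).1
      generalize prob P b k = t at ht
      cases ht with
      | one => exact key _ _ (by omega)
      | two => exact key _ _ (by omega)
      | degIn d h5 hd => exact two (P.gam_bounds h5 hd.le) (key _ _ (by omega)) (key _ _ (by omega))
      | degOut d h5 hd => exact two (P.gam_bounds h5 hd) (key _ _ (by omega)) (key _ _ (by omega))
      | degMax => exact two (P.gam_bounds hD le_rfl) (key _ _ (by omega)) (key _ _ (by omega))
      | lam1Out r h3 h7 | lam1In r h3 h7 =>
        exact two (P.lam1_bounds h3 h7) (key _ _ (by omega)) (key _ _ (by omega))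
      | lam2Out r h3 h4 | lam2In r h3 h4 =>
        exact two (P.lam2_bounds h3 h4) (key _ _ (by omega)) (key _ _ (by omega))
      | lam3Out | lam3In => exact two P.lam3_bounds (key _ _ (by omega)) (key _ _ (by omega))
      | del1 r h5 h7 | del2 r h5 h7 | del3 r h5 h7 | del4 r h5 h7 =>
        exact three r h5 h7 (key _ _ (by omega)) (key _ _ (by omega)) (key _ _ (by omega))
termination_by (b + 1).toNat
decreasing_by omega

/-- `p` is nondecreasing in the budget and nonincreasing in the cover size. -/
theorem prob_mono {b b' k k' : ℤ} (hb : b ≤ b') (hk : k' ≤ k) : prob P b k ≤ prob P b' k' := by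
  by_cases h0 : b < 0
  · rw [prob_of_neg P h0]; exact prob_nonneg P _ _
  · by_cases hk' : k' ≤ 0
    · rw [prob_of_nonpos P (by omega : 0 ≤ b') hk']; exact prob_le_one P _ _
    -- The term attaining the minimum at `(b', k')` is transported to `(b, k)`. Its side condition
    -- survives because it is a lower bound on the cover size and `k' ≤ k`.
    · obtain ⟨t, ht, hle⟩ := Term.exists_le P hk
        (fun c j hc => prob_mono (by omega : b - c ≤ b' - c) (by omega : k' - j ≤ k - j))
        (prob_isLeast P (by omega : 0 ≤ b') (by omega : 1 ≤ k')).1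
      exact (prob_le_of_term P (by omega) (by omega) ht).trans hle
termination_by (b + 1).toNat
decreasing_by omega

end Recurrence

/-! ### Expectations of finitely supported laws -/

section Expect

variable {α β : Type*} [Fintype α] [Fintype β]

/-- The expectation of `f` under `μ`. -/
noncomputable def expect (μ : PMF α) (f : α → ℝ) : ℝ := ∑ a, (μ a).toReal * f a

theorem sum_toReal (μ : PMF α) : ∑ a, (μ a).toReal = 1 := by
  have h := μ.tsum_coe
  rw [tsum_fintype] at h
  rw [← ENNReal.toReal_sum (fun a _ => μ.apply_ne_top a), h, ENNReal.toReal_one]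

theorem expect_mono {μ : PMF α} {f g : α → ℝ} (h : ∀ a, f a ≤ g a) : expect μ f ≤ expect μ g :=
  Finset.sum_le_sum fun a _ => mul_le_mul_of_nonneg_left (h a) ENNReal.toReal_nonneg

theorem expect_nonneg {μ : PMF α} {f : α → ℝ} (h : ∀ a, 0 ≤ f a) : 0 ≤ expect μ f :=
  Finset.sum_nonneg fun a _ => mul_nonneg ENNReal.toReal_nonneg (h a)

theorem expect_const (μ : PMF α) (c : ℝ) : expect μ (fun _ => c) = c := by
  rw [expect, ← Finset.sum_mul, sum_toReal, one_mul]

theorem expect_bind (μ : PMF α) (κ : α → PMF β) (f : β → ℝ) :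
    expect (μ.bind κ) f = expect μ fun a => expect (κ a) f := by
  simp only [expect, PMF.bind_apply, tsum_fintype, Finset.mul_sum]
  rw [Finset.sum_comm]
  refine Finset.sum_congr rfl fun b _ => ?_
  rw [ENNReal.toReal_sum fun a _ => ENNReal.mul_ne_top (μ.apply_ne_top a) ((κ a).apply_ne_top b),
    Finset.sum_mul]
  simp only [ENNReal.toReal_mul, mul_assoc]

theorem expect_pure (a : α) (f : α → ℝ) : expect (PMF.pure a) f = f a := by
  classical
  rw [expect, Finset.sum_eq_single a]
  · simp
  · intro b _ hb; simp [PMF.pure_apply, hb]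
  · simp

theorem expect_map (μ : PMF α) (g : α → β) (f : β → ℝ) :
    expect (μ.map g) f = expect μ fun a => f (g a) := by
  rw [PMF.map, expect_bind]
  simp only [Function.comp_apply, expect_pure]

/-- Used for the rule returning the smaller of two covers, where either of the two independent calls
may have to be treated as the outer one. -/
theorem expect_comm (μ : PMF α) (ν : PMF β) (f : α → β → ℝ) :
    expect μ (fun a => expect ν (f a)) = expect ν fun b => expect μ fun a => f a b := by
  simp only [expect, Finset.mul_sum]
  rw [Finset.sum_comm]
  exact Finset.sum_congr rfl fun _ _ => Finset.sum_congr rfl fun _ _ => by ring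

theorem expect_choose {n : ℕ} (w : Fin n → ℝ) (hw : w ∈ stdSimplex ℝ (Fin n)) (f : Fin n → ℝ) :
    expect (choose w hw) f = ∑ i, w i * f i := by
  refine Finset.sum_congr rfl fun i _ => ?_
  rw [choose, PMF.ofFintype_apply, ENNReal.toReal_ofReal (hw.1 i)]

/-- A function that is at most the indicator of `s` on the support of `μ` has expectation at most
the probability of `s`. -/
theorem expect_le_toOuterMeasure {μ : PMF α} {f : α → ℝ} {s : Set α} (h1 : ∀ a, f a ≤ 1)
    (h0 : ∀ a ∈ μ.support, a ∉ s → f a ≤ 0) : expect μ f ≤ (μ.toOuterMeasure s).toReal := by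
  classical
  rw [PMF.toOuterMeasure_apply_fintype, ENNReal.toReal_sum]
  · refine Finset.sum_le_sum fun a _ => ?_
    by_cases ha : a ∈ s
    · rw [Set.indicator_of_mem ha]
      exact mul_le_of_le_one_right ENNReal.toReal_nonneg (h1 a)
    · rw [Set.indicator_of_notMem ha, ENNReal.toReal_zero]
      by_cases hs : a ∈ μ.support
      · exact mul_nonpos_of_nonneg_of_nonpos ENNReal.toReal_nonneg (h0 a hs ha)
      · rw [PMF.mem_support_iff, not_not] at hs
        simp [hs]
  · intro a _
    by_cases ha : a ∈ s
    · rw [Set.indicator_of_mem ha]; exact μ.apply_ne_top a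
    · rw [Set.indicator_of_notMem ha]; exact ENNReal.zero_ne_top

end Expect

/-! ### Vertex covers of induced subgraphs -/

section Covers

set_option linter.unusedSectionVars false

variable {V : Type*} [DecidableEq V] {P : Params} {G : SimpleGraph V} [DecidableRel G.Adj]
  {A C U : Finset V}

theorem mem_nbr {u v : V} : u ∈ nbr G A v ↔ u ∈ A ∧ G.Adj v u := by simp [nbr]

theorem mem_nbr_comm {u v : V} (hv : v ∈ A) (h : u ∈ nbr G A v) : v ∈ nbr G A u :=
  mem_nbr.2 ⟨hv, (mem_nbr.1 h).2.symm⟩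

theorem notMem_nbr_self {v : V} : v ∉ nbr G A v := fun h => G.irrefl (mem_nbr.1 h).2

theorem nbr_subset {v : V} : nbr G A v ⊆ A := Finset.filter_subset _ _

variable (G) in
/-- `C` contains an endpoint of every edge of the graph induced on `A`. -/
def Covers (A C : Finset V) : Prop := ∀ u ∈ A, ∀ v ∈ A, G.Adj u v → u ∈ C ∨ v ∈ C

variable (G) in
/-- The graph induced on `A` has a vertex cover of size at most `k`. -/
def HasCover (A : Finset V) (k : ℤ) : Prop := ∃ C, Covers G A C ∧ (C.card : ℤ) ≤ k

theorem Covers.nbr_subset {v : V} (h : Covers G A C) (hv : v ∈ A) (hvC : v ∉ C) :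
    nbr G A v ⊆ C := fun u hu =>
  (h v hv u (mem_nbr.1 hu).1 (mem_nbr.1 hu).2).resolve_left hvC

theorem Covers.mem_of_nbr {u v : V} (h : Covers G A C) (hv : v ∈ A) (hu : u ∈ nbr G A v)
    (huC : u ∉ C) : v ∈ C :=
  (h v hv u (mem_nbr.1 hu).1 (mem_nbr.1 hu).2).resolve_right huC

/-- After deleting `U`, a cover may drop the vertices in `U` and those that become isolated. -/
theorem Covers.hasCover_sdiff {T : Finset V} {k t : ℤ} (h : Covers G A C)
    (hk : (C.card : ℤ) ≤ k) (hT : T ⊆ C) (ht : t ≤ (T.card : ℤ))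
    (hU : ∀ x ∈ T, x ∈ U ∨ nbr G A x ⊆ U) : HasCover G (A \ U) (k - t) := by
  refine ⟨C \ T, ?_, ?_⟩
  · have key : ∀ u ∈ A \ U, ∀ v ∈ A \ U, G.Adj u v → u ∈ C → u ∈ C \ T := by
      intro u hu v hv huv huC
      refine Finset.mem_sdiff.2 ⟨huC, fun huT => ?_⟩
      rcases hU u huT with h1 | h1
      · exact (Finset.mem_sdiff.1 hu).2 h1
      · exact (Finset.mem_sdiff.1 hv).2 (h1 (mem_nbr.2 ⟨(Finset.mem_sdiff.1 hv).1, huv⟩))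
    intro u hu v hv huv
    exact (h u (Finset.mem_sdiff.1 hu).1 v (Finset.mem_sdiff.1 hv).1 huv).imp
      (key u hu v hv huv) (key v hv u hu huv.symm)
  · have := Finset.card_sdiff_add_card_eq_card hT
    omega

/-- If a cover misses at most one neighbour of `v`, there is a cover of at most the same size
that contains all neighbours of `v`. -/
theorem Covers.exists_nbr_subset {v x : V} (h : Covers G A C) (hv : v ∈ A)
    (hx : nbr G A v ⊆ insert x C) :
    ∃ C', Covers G A C' ∧ nbr G A v ⊆ C' ∧ C'.card ≤ C.card := by
  by_cases hsub : nbr G A v ⊆ C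
  · exact ⟨C, h, hsub, le_rfl⟩
  obtain ⟨y, hy, hyC⟩ := Finset.not_subset.1 hsub
  have hyx : y = x := (Finset.mem_insert.1 (hx hy)).resolve_right hyC
  subst hyx
  have hvC : v ∈ C := h.mem_of_nbr hv hy hyC
  -- The exchange: `v` is in the cover because `y` is not, and `v` is swapped for `y`. Edges at `v`
  -- stay covered since all neighbours of `v` are now present.
  have hN : nbr G A v ⊆ insert y (C.erase v) := fun u hu => by
    have := hx hu
    rw [Finset.mem_insert] at this ⊢
    refine this.imp_right fun h' => Finset.mem_erase.2 ⟨?_, h'⟩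
    rintro rfl
    exact notMem_nbr_self hu
  have key : ∀ a ∈ A, ∀ b ∈ A, G.Adj a b → a ∈ C →
      a ∈ insert y (C.erase v) ∨ b ∈ insert y (C.erase v) := by
    intro a _ b hb hab haC
    by_cases hav : a = v
    · subst hav; exact Or.inr (hN (mem_nbr.2 ⟨hb, hab⟩))
    · exact Or.inl (Finset.mem_insert_of_mem (Finset.mem_erase.2 ⟨hav, haC⟩))
  refine ⟨insert y (C.erase v), fun a ha b hb hab => ?_, hN, ?_⟩
  · rcases h a ha b hb hab with h1 | h1
    · exact key a ha b hb hab h1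
    · exact (key b hb a ha hab.symm h1).symm
  · have := Finset.card_insert_le y (C.erase v)
    have := Finset.card_erase_add_one hvC
    omega

/-- The two ways a cover can meet the neighbourhood of `v`. -/
theorem Covers.nbr_dichotomy {v : V} {k : ℤ} (h : Covers G A C) (hk : (C.card : ℤ) ≤ k)
    (hv : v ∈ A) :
    (∃ C', Covers G A C' ∧ (C'.card : ℤ) ≤ k ∧ nbr G A v ⊆ C') ∨
      v ∈ C ∧ ∀ x, ¬ nbr G A v ⊆ insert x C := by
  by_cases hx : ∃ x, nbr G A v ⊆ insert x C
  · obtain ⟨x, hx⟩ := hx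
    obtain ⟨C', h1, h2, h3⟩ := h.exists_nbr_subset hv hx
    exact Or.inl ⟨C', h1, by omega, h2⟩
  · push Not at hx
    refine Or.inr ⟨?_, hx⟩
    by_contra hvC
    -- If `v` is outside the cover, no neighbour is missed, so any inserted vertex would serve; `v`
    -- is an arbitrary choice.
    exact hx v ((h.nbr_subset hv hvC).trans (Finset.subset_insert _ _))

/-! ### Edges, connectedness and vertex degrees -/

theorem exists_adj_of_not_trivial (h : ¬ Trivial G A) : ∃ u ∈ A, ∃ v ∈ A, G.Adj u v := by
  by_contra hne
  push Not at hne
  exact h fun u v huv => absurd huv (hne u u.2 v v.2)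

theorem HasCover.nonneg {k : ℤ} (h : HasCover G A k) : 0 ≤ k := by
  obtain ⟨C, _, hC⟩ := h; omega

/-- Supplies the condition `1 ≤ k` under which p is given by the minimum. -/
theorem Covers.one_le {k : ℤ} (h : Covers G A C) (hk : (C.card : ℤ) ≤ k) (ht : ¬ Trivial G A) :
    1 ≤ k := by
  obtain ⟨u, hu, v, hv, huv⟩ := exists_adj_of_not_trivial ht
  have : C.Nonempty := (h u hu v hv huv).elim (fun h => ⟨_, h⟩) fun h => ⟨_, h⟩
  have := this.card_pos
  omega

/-- A property that spreads along edges holds everywhere in a connected graph. -/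
theorem forall_of_connected (hA : (G.induce (A : Set V)).Connected) {Q : V → Prop} {u : V}
    (hu : u ∈ A) (hQ : Q u) (h : ∀ a ∈ A, ∀ b ∈ A, G.Adj a b → Q a → Q b) : ∀ v ∈ A, Q v := by
  intro v hv
  obtain ⟨w⟩ := hA.preconnected ⟨u, hu⟩ ⟨v, hv⟩
  have key : ∀ {a b : (A : Set V)}, (G.induce (A : Set V)).Walk a b → Q a → Q b := by
    intro a b w
    induction w with
    | nil => exact id
    | cons hadj _ ih => exact fun hq => ih (h _ (Subtype.prop _) _ (Subtype.prop _) hadj hq)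
  exact key w hQ

theorem PastSplit.deg_pos (h : PastSplit G A) {v : V} (hv : v ∈ A) : 1 ≤ deg G A v := by
  by_contra h0
  have hN : nbr G A v = ∅ := Finset.card_eq_zero.1 (by unfold deg at h0; omega)
  -- An isolated vertex in a connected graph is the only vertex, which leaves no edge and
  -- contradicts nontriviality.
  have hall : ∀ u ∈ A, u = v := forall_of_connected h.2 hv rfl fun a _ b hb hab hav => by
    subst hav
    have : b ∈ nbr G A a := mem_nbr.2 ⟨hb, hab⟩
    simp [hN] at this
  obtain ⟨a, ha, b, hb, hab⟩ := exists_adj_of_not_trivial h.1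
  rw [hall a ha, hall b hb] at hab
  exact G.irrefl hab

theorem PastHighDeg.deg_bounds (h : PastHighDeg G A) {v : V} (hv : v ∈ A) :
    2 ≤ deg G A v ∧ deg G A v ≤ 4 := by
  have h1 := h.1.1.deg_pos hv
  have h2 := h.1.2 v hv
  have h3 := h.2 v hv
  omega

theorem PastDegTwo.deg_bounds (h : PastDegTwo G A) {v : V} (hv : v ∈ A) :
    3 ≤ deg G A v ∧ deg G A v ≤ 4 := by
  have h1 := h.1.1.deg_bounds hv
  have h2 := h.2 v hv
  omega

/-- The index of the branching on a vertex of degree two. -/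
theorem card_union_of_not_square {v x y : V} (hA : PastRegular G A) (hv : v ∈ A)
    (hN : nbr G A v = {x, y}) (hsq : ∀ z, ¬ Square G A v x y z) :
    3 ≤ (nbr G A x ∪ nbr G A y).card ∧ (nbr G A x ∪ nbr G A y).card ≤ 7 := by
  have hx : x ∈ nbr G A v := by simp [hN]
  have hy : y ∈ nbr G A v := by simp [hN]
  have hdx := hA.1.deg_bounds (nbr_subset hx)
  have hdy := hA.1.deg_bounds (nbr_subset hy)
  have hvx := mem_nbr_comm hv hx
  have hvy := mem_nbr_comm hv hy
  unfold deg at hdx hdy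
  have hui := Finset.card_union_add_card_inter (nbr G A x) (nbr G A y)
  have hi : 1 ≤ (nbr G A x ∩ nbr G A y).card :=
    Finset.card_pos.2 ⟨v, Finset.mem_inter.2 ⟨hvx, hvy⟩⟩
  refine ⟨?_, by omega⟩
  -- Each neighbourhood has at least two elements, so a union of size at most two forces them to
  -- coincide, and this is the excluded square.
  by_contra hlt
  have ex : nbr G A x = nbr G A x ∪ nbr G A y :=
    Finset.eq_of_subset_of_card_le Finset.subset_union_left (by omega)
  have ey : nbr G A y = nbr G A x ∪ nbr G A y :=
    Finset.eq_of_subset_of_card_le Finset.subset_union_right (by omega)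
  have exy : nbr G A y = nbr G A x := ey.trans ex.symm
  have hx2 : (nbr G A x).card = 2 := by rw [← ex] at hlt; omega
  have he : ((nbr G A x).erase v).card = 1 := by rw [Finset.card_erase_of_mem hvx, hx2]
  obtain ⟨z, hz⟩ := Finset.card_eq_one.1 he
  have hzv : nbr G A x = {z, v} := by
    rw [← Finset.insert_erase hvx, hz, Finset.pair_comm]
  exact hsq z ⟨hx2, by rw [deg, exy, hx2], hzv, exy.trans hzv⟩

/-! ### Neighbours of a vertex of degree three -/

theorem not_adj_of_not_hasTriangle {v x y : V} (h : ¬ HasTriangle G A v) (hx : x ∈ nbr G A v)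
    (hy : y ∈ nbr G A v) : ¬ G.Adj x y := fun hxy => h ⟨x, hx, y, hy, hxy⟩

/-- Without triangles and common neighbours, the neighbourhoods of two neighbours of `v`
meet in `v` only. -/
theorem nbr_inter_nbr {v x y : V} (ht : ¬ HasTriangle G A v) (hc : ¬ HasCommon G A v)
    (hv : v ∈ A) (hx : x ∈ nbr G A v) (hy : y ∈ nbr G A v) (hxy : x ≠ y) :
    nbr G A x ∩ nbr G A y = {v} := by
  ext w
  rw [Finset.mem_inter, Finset.mem_singleton]
  constructor
  · rintro ⟨hwx, hwy⟩
    by_contra hwv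
    have hwN : w ∉ nbr G A v := fun hw =>
      not_adj_of_not_hasTriangle ht hx hw (mem_nbr.1 hwx).2
    exact hc ⟨x, hx, y, hy, hxy, w, nbr_subset hwx, hwN, hwv,
      mem_nbr_comm (nbr_subset hx) hwx, mem_nbr_comm (nbr_subset hy) hwy⟩
  · rintro rfl
    exact ⟨mem_nbr_comm hv hx, mem_nbr_comm hv hy⟩

/-- Inclusion–exclusion with intersection `{v}`. Since the degrees are 3 or 4 when it is applied, it
places the index of the last rule between 5 and 7. -/
theorem card_union_nbr {v x y : V} (ht : ¬ HasTriangle G A v) (hc : ¬ HasCommon G A v)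
    (hv : v ∈ A) (hx : x ∈ nbr G A v) (hy : y ∈ nbr G A v) (hxy : x ≠ y) :
    (nbr G A x ∪ nbr G A y).card + 1 = deg G A x + deg G A y := by
  rw [deg, deg, ← Finset.card_union_add_card_inter, nbr_inter_nbr ht hc hv hx hy hxy,
    Finset.card_singleton]

theorem ne_of_card_three {v x y z : V} (hd : deg G A v = 3) (hN : nbr G A v = {x, y, z}) :
    x ≠ y ∧ x ≠ z ∧ y ≠ z := by
  have h3 : ({x, y, z} : Finset V).card = 3 := by rw [← hN]; exact hd
  refine ⟨?_, ?_, ?_⟩ <;> rintro rfl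
  · have := Finset.card_le_two (a := x) (b := z); simp_all
  · have := Finset.card_le_two (a := x) (b := y)
    rw [show ({x, y, x} : Finset V) = {x, y} by ext; simp; tauto] at h3
    omega
  · have := Finset.card_le_two (a := x) (b := y); simp_all

theorem ne_of_card_two {v x y : V} (hd : deg G A v = 2) (hN : nbr G A v = {x, y}) : x ≠ y := by
  rintro rfl
  rw [deg, hN] at hd
  simp at hd

/-- In the last rule, a cover that contains the neighbourhood of `v` has a fourth vertex. -/
theorem Covers.four_le {v x y z : V} {k : ℤ} (h : Covers G A C) (hk : (C.card : ℤ) ≤ k)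
    (hA : PastDegTwo G A) (hd : deg G A v = 3) (hN : nbr G A v = {x, y, z})
    (ht : ¬ HasTriangle G A v) (hc : ¬ HasCommon G A v) (hdx : deg G A x = 4)
    (hsub : nbr G A v ⊆ C) : 4 ≤ k := by
  by_contra hlt
  have hC : nbr G A v = C := Finset.eq_of_subset_of_card_le hsub (by unfold deg at hd; omega)
  have hx : x ∈ nbr G A v := by simp [hN]
  have hy : y ∈ nbr G A v := by simp [hN]
  obtain ⟨w, hw, hwv⟩ : ∃ w ∈ nbr G A x, w ≠ v :=
    Finset.exists_mem_ne (by unfold deg at hdx; omega) v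
  have hwN : w ∉ nbr G A v := fun hw' =>
    not_adj_of_not_hasTriangle ht hx hw' (mem_nbr.1 hw).2
  have hwA := BetterVC.nbr_subset hw
  -- If `C` is just the neighbourhood of `v`, then `w` lies outside it, so its at least three
  -- neighbours fill `C`. This makes `w` a forbidden common neighbour.
  have hNw : nbr G A w = nbr G A v := by
    refine Finset.eq_of_subset_of_card_le ?_ ?_
    · rw [hC]; exact h.nbr_subset hwA (hC ▸ hwN)
    · have := (hA.deg_bounds hwA).1
      unfold deg at this hd
      omega
  exact hc ⟨x, hx, y, hy, (ne_of_card_three hd hN).1, w, hwA, hwN, hwv, hNw ▸ hx, hNw ▸ hy⟩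

end Covers

/-! ### The effect of a single step -/

section Steps

set_option linter.unusedSectionVars false

variable {V : Type*} [DecidableEq V] {P : Params} {G : SimpleGraph V} [DecidableRel G.Adj]
  {A : Finset V}

/-- A selection is safe: some optimal cover contains `U`, or, for the square, deleting `U` isolates
equally many cover vertices. The inequality is required for all `K ≥ k` because the main estimate
applies it at `k + m`. -/
theorem Step.select_bound {U : Finset V} {k : ℤ} (hs : Step P G A (.select U))
    (hC : HasCover G A k) : HasCover G (A \ U) (k - U.card) ∧ ∀ K b : ℤ, k ≤ K → 0 ≤ b →
      prob P b K ≤ prob P (b - U.card) (K - U.card) := by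
  obtain ⟨C, hC, hk⟩ := hC
  cases hs with
  | degOne v u hA hv hN =>
    obtain ⟨C', h1, h2, h3⟩ := hC.exists_nbr_subset (x := u) hv (by simp [hN])
    rw [hN] at h2
    have hk1 := h1.one_le (k := k) (by omega) hA.1
    refine ⟨h1.hasCover_sdiff (by omega) h2 le_rfl fun x hx => Or.inl hx, fun K b hK hb => ?_⟩
    simpa using prob_le_of_term P hb (by omega) .one
  | twoTriangle v x y hA hv hd hN hxy =>
    have hne := ne_of_card_two hd hN
    have hx : x ∈ A := nbr_subset (G := G) (v := v) (by simp [hN])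
    have hy : y ∈ A := nbr_subset (G := G) (v := v) (by simp [hN])
    -- The edge `xy` puts one of its ends in the cover, so at most one neighbour of `v` is missed
    -- and the exchange applies.
    obtain ⟨C', h1, h2, h3⟩ : ∃ C', Covers G A C' ∧ nbr G A v ⊆ C' ∧ C'.card ≤ C.card := by
      rcases hC x hx y hy hxy with h | h
      · exact hC.exists_nbr_subset (x := y) hv (by simp [hN, Finset.insert_subset_iff, h])
      · exact hC.exists_nbr_subset (x := x) hv (by simp [hN, Finset.insert_subset_iff, h])
    rw [hN] at h2
    have hc := Finset.card_le_card h2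
    rw [Finset.card_pair hne] at hc
    refine ⟨h1.hasCover_sdiff (by omega) h2 le_rfl fun x hx => Or.inl hx, fun K b hK hb => ?_⟩
    rw [Finset.card_pair hne]
    exact prob_le_of_term P hb (by omega) (.two (by omega))
  | twoSquare v x y z hA hv hd hN hxy hsq =>
    obtain ⟨hdx, -, hNx, hNy⟩ := hsq
    have hne := ne_of_card_two hd hN
    have hzv := ne_of_card_two hdx hNx
    have hx : x ∈ A := nbr_subset (G := G) (v := v) (by simp [hN])
    have hy : y ∈ A := nbr_subset (G := G) (v := v) (by simp [hN])
    have hz : z ∈ A := nbr_subset (G := G) (v := x) (by simp [hNx])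
    have hxz : x ∈ nbr G A z := mem_nbr_comm hx (by simp [hNx])
    have hyz : y ∈ nbr G A z := mem_nbr_comm hy (by simp [hNy])
    -- The cover contains one of the two diagonals of the square.
    have hdiag : ({z, v} : Finset V) ⊆ C ∨ ({x, y} : Finset V) ⊆ C := by
      by_cases hzC : z ∈ C
      · by_cases hvC : v ∈ C
        · exact Or.inl (by simp [Finset.insert_subset_iff, hzC, hvC])
        · exact Or.inr (hN ▸ hC.nbr_subset hv hvC)
      · have := hC.nbr_subset hz hzC
        exact Or.inr (by simp [Finset.insert_subset_iff, this hxz, this hyz])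
    have hk2 : (2 : ℤ) ≤ k := by
      rcases hdiag with h | h
      · have := Finset.card_le_card h
        rw [Finset.card_pair hzv] at this; omega
      · have := Finset.card_le_card h
        rw [Finset.card_pair hne] at this; omega
    rw [Finset.card_pair hzv]
    refine ⟨?_, fun K b hK hb => prob_le_of_term P hb (by omega) (.two (by omega))⟩
    rcases hdiag with h | h
    · exact hC.hasCover_sdiff hk h (by rw [Finset.card_pair hzv]) fun x hx => Or.inl hx
    -- Here the cover contains the other diagonal. Deleting `z` and `v` isolates `x` and `y`, so
    -- those two are dropped.
    · refine hC.hasCover_sdiff hk h (by rw [Finset.card_pair hne]) fun u hu => Or.inr ?_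
      rcases Finset.mem_insert.1 hu with rfl | hu
      · exact hNx.subset
      · rw [Finset.mem_singleton.1 hu, hNy]

theorem Step.best_bound {v₁ v₂ : V} {k : ℤ} (hs : Step P G A (.best v₁ v₂))
    (hC : HasCover G A k) :
    (HasCover G (A \ {v₁}) (k - 1) ∨ HasCover G (A \ {v₂}) (k - 1)) ∧
      ∀ K b : ℤ, k ≤ K → 0 ≤ b → prob P b K ≤ prob P (b - 1) (K - 1) := by
  obtain ⟨C, hC, hk⟩ := hC
  cases hs with
  | regular _ _ hA _ h1 h2 h12 =>
    have hk1 := hC.one_le hk hA.1.1.1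
    refine ⟨?_, fun K b hK hb => prob_le_of_term P hb (by omega) .one⟩
    rcases hC _ h1 _ h2 h12 with h | h
    · exact Or.inl (hC.hasCover_sdiff (T := {v₁}) hk (by simpa using h) (by simp) (by simp))
    · exact Or.inr (hC.hasCover_sdiff (T := {v₂}) hk (by simpa using h) (by simp) (by simp))

variable (P G A) in
/-- The branches `U i` leave graphs with covers of sizes `κ i` such that the corresponding
combination of values of `p` is an upper bound for the value at the current size. -/
def BranchBound (k : ℤ) (n : ℕ) (w : Fin n → ℝ) (U : Fin n → Finset V) : Prop :=
  ∃ κ : Fin n → ℤ, (∀ i, HasCover G (A \ U i) (κ i)) ∧ ∀ m b : ℤ, 0 ≤ m → 0 ≤ b →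
    prob P b (k + m) ≤ ∑ i, w i * prob P (b - (U i).card) (κ i + m)

/-- Here `j₁`, `j₂` are the drops in cover size. The side conditions of the recurrence are lower
bounds on the size, so checking them at `k` serves every `K ≥ k`. -/
theorem BranchBound.of_two {k : ℤ} {w₁ w₂ : ℝ} {U₁ U₂ : Finset V} (j₁ j₂ : ℤ)
    (h₁ : HasCover G (A \ U₁) (k - j₁)) (h₂ : HasCover G (A \ U₂) (k - j₂))
    (h : ∀ K b : ℤ, k ≤ K → 0 ≤ b → prob P b K ≤
      w₁ * prob P (b - U₁.card) (K - j₁) + w₂ * prob P (b - U₂.card) (K - j₂)) :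
    BranchBound P G A k 2 ![w₁, w₂] ![U₁, U₂] := by
  refine ⟨![k - j₁, k - j₂], Fin.forall_fin_two.2 ⟨h₁, h₂⟩, fun m b hm hb => ?_⟩
  have := h (k + m) b (by omega) hb
  simpa [Fin.sum_univ_two, add_sub_right_comm] using this

theorem BranchBound.of_three {k : ℤ} {w₁ w₂ w₃ : ℝ} {U₁ U₂ U₃ : Finset V} (j₁ j₂ j₃ : ℤ)
    (h₁ : HasCover G (A \ U₁) (k - j₁)) (h₂ : HasCover G (A \ U₂) (k - j₂))
    (h₃ : HasCover G (A \ U₃) (k - j₃))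
    (h : ∀ K b : ℤ, k ≤ K → 0 ≤ b → prob P b K ≤ w₁ * prob P (b - U₁.card) (K - j₁) +
      w₂ * prob P (b - U₂.card) (K - j₂) + w₃ * prob P (b - U₃.card) (K - j₃)) :
    BranchBound P G A k 3 ![w₁, w₂, w₃] ![U₁, U₂, U₃] := by
  refine ⟨![k - j₁, k - j₂, k - j₃], fun i => ?_, fun m b hm hb => ?_⟩
  · fin_cases i
    exacts [h₁, h₂, h₃]
  · have := h (k + m) b (by omega) hb
    simpa [Fin.sum_univ_three, add_sub_right_comm] using this

/-- If `v ∈ C`, both branches gain one, since deleting the neighbourhood isolates `v`. If `v ∉ C`,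
deleting `v` gains nothing, but the whole neighbourhood lies in `C`. -/
theorem branchBound_degHigh {v : V} {k : ℤ} (hA : PastDegOne G A) (hv : v ∈ A)
    (h5 : 5 ≤ deg G A v) (hD : deg G A v < P.Delta) (hC : HasCover G A k) :
    BranchBound P G A k 2 ![P.gam (deg G A v), 1 - P.gam (deg G A v)] ![{v}, nbr G A v] := by
  obtain ⟨C, hC, hk⟩ := hC
  have hk1 := hC.one_le hk hA.1.1
  by_cases hvC : v ∈ C
  · refine .of_two 1 1 (hC.hasCover_sdiff (T := {v}) hk (by simpa) (by simp) (by simp))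
      (hC.hasCover_sdiff (T := {v}) hk (by simpa) (by simp) (by simp)) fun K b hK hb => ?_
    simpa [deg] using prob_le_of_term P hb (by omega) (.degIn _ h5 hD)
  · have hN := hC.nbr_subset hv hvC
    have hc : deg G A v ≤ C.card := Finset.card_le_card hN
    refine .of_two 0 (deg G A v)
      (hC.hasCover_sdiff (T := ∅) hk (by simp) (by simp) (by simp))
      (hC.hasCover_sdiff hk hN le_rfl fun x hx => Or.inl hx) fun K b hK hb => ?_
    simpa [deg] using prob_le_of_term P hb (by omega) (.degOut _ h5 hD.le (by omega))

/-- Unlike deletion of a full neighbourhood, deleting `U` need not isolate `v`, so when `v ∈ C` the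
second branch is credited with no gain. -/
theorem branchBound_degVeryHigh {v : V} {U : Finset V} {k : ℤ} (hA : PastDegOne G A)
    (hv : v ∈ A) (hU : U ⊆ nbr G A v) (hc : U.card = P.Delta) (hC : HasCover G A k) :
    BranchBound P G A k 2 ![P.gam P.Delta, 1 - P.gam P.Delta] ![{v}, U] := by
  obtain ⟨C, hC, hk⟩ := hC
  have hk1 := hC.one_le hk hA.1.1
  by_cases hvC : v ∈ C
  · refine .of_two 1 0 (hC.hasCover_sdiff (T := {v}) hk (by simpa) (by simp) (by simp))
      (hC.hasCover_sdiff (T := ∅) hk (by simp) (by simp) (by simp)) fun K b hK hb => ?_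
    simpa [hc] using prob_le_of_term P hb (by omega) .degMax
  · have hN := hU.trans (hC.nbr_subset hv hvC)
    have hc' : U.card ≤ C.card := Finset.card_le_card hN
    refine .of_two 0 U.card
      (hC.hasCover_sdiff (T := ∅) hk (by simp) (by simp) (by simp))
      (hC.hasCover_sdiff hk hN le_rfl fun x hx => Or.inl hx) fun K b hK hb => ?_
    simpa [hc] using
      prob_le_of_term P hb (by omega) (.degOut _ P.five_le_Delta le_rfl (by omega))

/-- If the cover contains `x` and `y`, the second branch isolates them and also gains two. Otherwise
both are missed, so both their neighbourhoods lie in the cover, and the first branch isolates `v`.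
-/
theorem branchBound_twoOther {v x y : V} {k : ℤ} (hA : PastRegular G A) (hv : v ∈ A)
    (hd : deg G A v = 2) (hN : nbr G A v = {x, y}) (hsq : ∀ z, ¬ Square G A v x y z)
    (hC : HasCover G A k) :
    BranchBound P G A k 2
      ![P.lam1 (nbr G A x ∪ nbr G A y).card, 1 - P.lam1 (nbr G A x ∪ nbr G A y).card]
      ![nbr G A v, nbr G A x ∪ nbr G A y] := by
  obtain ⟨C, hC, hk⟩ := hC
  have hr := card_union_of_not_square hA hv hN hsq
  have hx : x ∈ A := nbr_subset (G := G) (v := v) (by simp [hN])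
  have hy : y ∈ A := nbr_subset (G := G) (v := v) (by simp [hN])
  have hd' : (nbr G A v).card = 2 := hd
  rcases hC.nbr_dichotomy hk hv with ⟨C', h1, h2, h3⟩ | ⟨h1, h2⟩
  · have hc := Finset.card_le_card h3
    refine .of_two 2 2 (h1.hasCover_sdiff h2 h3 (by omega) fun x hx => Or.inl hx)
      (h1.hasCover_sdiff h2 h3 (by omega) ?_) fun K b hK hb => ?_
    · intro u hu
      rw [hN, Finset.mem_insert, Finset.mem_singleton] at hu
      rcases hu with rfl | rfl
      · exact Or.inr Finset.subset_union_left
      · exact Or.inr Finset.subset_union_right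
    · simpa [hd'] using prob_le_of_term P hb (by omega) (.lam1Out _ hr.1 hr.2 (by omega))
  · have hxC : x ∉ C := fun h => h2 y (by simp [hN, Finset.insert_subset_iff, h])
    have hyC : y ∉ C := fun h => h2 x (by simp [hN, Finset.insert_subset_iff, h])
    have hsub := Finset.union_subset (hC.nbr_subset hx hxC) (hC.nbr_subset hy hyC)
    have hc := Finset.card_le_card hsub
    refine .of_two 1 (nbr G A x ∪ nbr G A y).card
      (hC.hasCover_sdiff (T := {v}) hk (by simpa) (by simp) (by simp))
      (hC.hasCover_sdiff hk hsub le_rfl fun x hx => Or.inl hx) fun K b hK hb => ?_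
    simpa [hd'] using prob_le_of_term P hb (by omega) (.lam1In _ hr.1 hr.2 (by omega))

/-- A cover missing two neighbours of `v` must miss `z`, because the edge `xy` keeps one of `x`, `y`
in it. -/
theorem branchBound_threeTriangle {v x y z : V} {k : ℤ} (hA : PastDegTwo G A) (hv : v ∈ A)
    (hd : deg G A v = 3) (hN : nbr G A v = {x, y, z}) (hxy : G.Adj x y) (hC : HasCover G A k) :
    BranchBound P G A k 2 ![P.lam2 (nbr G A z).card, 1 - P.lam2 (nbr G A z).card]
      ![nbr G A v, nbr G A z] := by
  obtain ⟨C, hC, hk⟩ := hC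
  have hx : x ∈ A := nbr_subset (G := G) (v := v) (by simp [hN])
  have hy : y ∈ A := nbr_subset (G := G) (v := v) (by simp [hN])
  have hz : z ∈ A := nbr_subset (G := G) (v := v) (by simp [hN])
  have hd' : (nbr G A v).card = 3 := hd
  have hr : 3 ≤ (nbr G A z).card ∧ (nbr G A z).card ≤ 4 := hA.deg_bounds hz
  rcases hC.nbr_dichotomy hk hv with ⟨C', h1, h2, h3⟩ | ⟨h1, h2⟩
  · have hc := Finset.card_le_card h3
    have hzC : z ∈ C' := h3 (by simp [hN])
    refine .of_two 3 1 (h1.hasCover_sdiff h2 h3 (by omega) fun x hx => Or.inl hx)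
      (h1.hasCover_sdiff (T := {z}) h2 (by simpa) (by simp) (by simp)) fun K b hK hb => ?_
    simpa [hd'] using prob_le_of_term P hb (by omega) (.lam2Out _ hr.1 hr.2 (by omega))
  · have hzC : z ∉ C := fun h => by
      rcases hC x hx y hy hxy with h' | h'
      · exact h2 y (by simp [hN, Finset.insert_subset_iff, h, h'])
      · exact h2 x (by simp [hN, Finset.insert_subset_iff, h, h'])
    have hsub := hC.nbr_subset hz hzC
    have hc := Finset.card_le_card hsub
    refine .of_two 1 (nbr G A z).card
      (hC.hasCover_sdiff (T := {v}) hk (by simpa) (by simp) (by simp))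
      (hC.hasCover_sdiff hk hsub le_rfl fun x hx => Or.inl hx) fun K b hK hb => ?_
    simpa [hd'] using prob_le_of_term P hb (by omega) (.lam2In _ hr.1 hr.2 (by omega))

/-- If `w` is not in the cover, then `x` and `y` are, so at most `z` is missed. Hence a cover
missing two neighbours of `v` contains both `v` and `w`. -/
theorem branchBound_threeCommon {v x y z w : V} {k : ℤ} (hv : v ∈ A)
    (hd : deg G A v = 3) (hN : nbr G A v = {x, y, z}) (hw : w ∈ A) (hwv : w ≠ v)
    (hxw : x ∈ nbr G A w) (hyw : y ∈ nbr G A w) (hC : HasCover G A k) :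
    BranchBound P G A k 2 ![P.lam3, 1 - P.lam3] ![nbr G A v, {v, w}] := by
  obtain ⟨C, hC, hk⟩ := hC
  have hd' : (nbr G A v).card = 3 := hd
  have hvw : ({v, w} : Finset V).card = 2 := Finset.card_pair hwv.symm
  rcases hC.nbr_dichotomy hk hv with ⟨C', h1, h2, h3⟩ | ⟨h1, h2⟩
  · have hc := Finset.card_le_card h3
    refine .of_two 3 0 (h1.hasCover_sdiff h2 h3 (by omega) fun x hx => Or.inl hx)
      (h1.hasCover_sdiff (T := ∅) h2 (by simp) (by simp) (by simp)) fun K b hK hb => ?_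
    simpa [hd', hvw] using prob_le_of_term P hb (by omega) (.lam3Out (by omega))
  · have hwC : w ∈ C := by
      by_contra h
      have := hC.nbr_subset hw h
      exact h2 z (by simp [hN, Finset.insert_subset_iff, this hxw, this hyw])
    have hsub : ({v, w} : Finset V) ⊆ C := by simp [Finset.insert_subset_iff, h1, hwC]
    have hc := Finset.card_le_card hsub
    refine .of_two 1 2 (hC.hasCover_sdiff (T := {v}) hk (by simpa) (by simp) (by simp))
      (hC.hasCover_sdiff hk hsub (by simp [hvw]) fun x hx => Or.inl hx) fun K b hK hb => ?_
    simpa [hd', hvw] using prob_le_of_term P hb (by omega) (.lam3In (by omega))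

/-- The four terms for this rule correspond to the trace of the cover on the neighbours of `v`: all
of them, none, exactly one of `y` and `z`, or exactly `x`. -/
theorem branchBound_threeFour {v x y z : V} {k : ℤ} (hA : PastDegTwo G A) (hv : v ∈ A)
    (hd : deg G A v = 3) (hN : nbr G A v = {x, y, z}) (ht : ¬ HasTriangle G A v)
    (hcm : ¬ HasCommon G A v) (hdx : deg G A x = 4) (hC : HasCover G A k) :
    BranchBound P G A k 3
      ![P.del1 (nbr G A y ∪ nbr G A z).card, P.del2 (nbr G A y ∪ nbr G A z).card,
        P.del3 (nbr G A y ∪ nbr G A z).card]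
      ![nbr G A v, nbr G A x, {x} ∪ nbr G A y ∪ nbr G A z] := by
  obtain ⟨C, hC, hk⟩ := hC
  obtain ⟨hxy, hxz, hyz⟩ := ne_of_card_three hd hN
  have hx : x ∈ nbr G A v := by simp [hN]
  have hy : y ∈ nbr G A v := by simp [hN]
  have hz : z ∈ nbr G A v := by simp [hN]
  have hdy := hA.deg_bounds (nbr_subset hy)
  have hdz := hA.deg_bounds (nbr_subset hz)
  have hr := card_union_nbr ht hcm hv hy hz hyz
  have hU : ({x} ∪ nbr G A y ∪ nbr G A z).card = (nbr G A y ∪ nbr G A z).card + 1 := by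
    rw [Finset.union_assoc, Finset.card_union_of_disjoint, Finset.card_singleton, add_comm]
    rw [Finset.disjoint_singleton_left, Finset.mem_union, not_or]
    exact ⟨fun h => not_adj_of_not_hasTriangle ht hy hx (mem_nbr.1 h).2,
      fun h => not_adj_of_not_hasTriangle ht hz hx (mem_nbr.1 h).2⟩
  have hyU : nbr G A y ⊆ {x} ∪ nbr G A y ∪ nbr G A z := fun u hu => by simp [hu]
  have hzU : nbr G A z ⊆ {x} ∪ nbr G A y ∪ nbr G A z := fun u hu => by simp [hu]
  have hxU : x ∈ {x} ∪ nbr G A y ∪ nbr G A z := by simp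
  have hsubU : ∀ {D : Finset V}, x ∈ D → nbr G A y ⊆ D → nbr G A z ⊆ D →
      {x} ∪ nbr G A y ∪ nbr G A z ⊆ D := fun h1 h2 h3 =>
    Finset.union_subset (Finset.union_subset (by simpa using h1) h2) h3
  have hd' : (nbr G A v).card = 3 := hd
  have hdx' : (nbr G A x).card = 4 := hdx
  have h5 : 5 ≤ (nbr G A y ∪ nbr G A z).card := by omega
  have h7 : (nbr G A y ∪ nbr G A z).card ≤ 7 := by omega
  set U := {x} ∪ nbr G A y ∪ nbr G A z with hUdef
  set r := (nbr G A y ∪ nbr G A z).card with hrdef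
  rcases hC.nbr_dichotomy hk hv with ⟨C', h1, h2, h3⟩ | ⟨h1, h2⟩
  · have h4 := h1.four_le h2 hA hd hN ht hcm hdx h3
    -- The branches gain, in turn: the deleted neighbourhood of `v`; `x`, isolated when its
    -- neighbourhood goes; `x`, deleted, together with `y` and `z`, isolated.
    refine .of_three 3 1 3 (h1.hasCover_sdiff h2 h3 (by omega) fun x hx => Or.inl hx)
      (h1.hasCover_sdiff (T := {x}) h2 (by simpa using h3 hx) (by simp) (by simp))
      (h1.hasCover_sdiff h2 h3 (by omega) ?_) fun K b hK hb => ?_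
    · intro u hu
      rw [hN, Finset.mem_insert, Finset.mem_insert, Finset.mem_singleton] at hu
      rcases hu with rfl | rfl | rfl
      exacts [Or.inl hxU, Or.inr hyU, Or.inr hzU]
    · have := prob_le_of_term P hb (by omega) (.del1 r h5 h7 (by omega : 4 ≤ K))
      simpa [hd', hdx', hU, sub_sub] using this
  have hxA := nbr_subset hx
  have hyA := nbr_subset hy
  have hzA := nbr_subset hz
  -- The case in which the cover contains exactly one neighbour of `v` other than `x`.
  have hone : ∀ p q : V, p ∈ nbr G A v → q ∈ nbr G A v → x ∉ C → p ∈ C → q ∉ C →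
      nbr G A p ⊆ U → nbr G A q ⊆ U → r ≤ 2 * deg G A q →
      BranchBound P G A k 3 ![P.del1 r, P.del2 r, P.del3 r] ![nbr G A v, nbr G A x, U] := by
    intro p q hp hq hxC hpC hqC hpU hqU hrq
    have hNx := hC.nbr_subset hxA hxC
    have hNq := hC.nbr_subset (nbr_subset hq) hqC
    have hpq : p ∉ nbr G A q := fun h => not_adj_of_not_hasTriangle ht hq hp (mem_nbr.1 h).2
    have hvp : v ≠ p := fun h => notMem_nbr_self (h ▸ hp)
    have hci : (insert p (nbr G A q)).card = deg G A q + 1 := Finset.card_insert_of_notMem hpq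
    have hsub : insert p (nbr G A q) ⊆ C := Finset.insert_subset hpC hNq
    have hcC := Finset.card_le_card hsub
    -- The degree of `q` is weakened to a bound depending on `r` alone, so that one term covers both
    -- choices of `q`.
    have hceil : ⌈(r : ℚ) / 2⌉ ≤ (deg G A q : ℤ) := by
      rw [Int.ceil_le, div_le_iff₀ (by norm_num)]
      have : (r : ℚ) ≤ ((2 * deg G A q : ℕ) : ℚ) := by exact_mod_cast hrq
      push_cast at this ⊢
      linarith
    -- First branch: `v` is isolated and `p` deleted. Second: the neighbourhood of `x` lies in the
    -- cover. Third: the neighbourhood of `q` is deleted and `p` becomes isolated.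
    refine .of_three 2 4 (1 + ⌈(r : ℚ) / 2⌉)
      (hC.hasCover_sdiff (T := {v, p}) hk (by simp [Finset.insert_subset_iff, h1, hpC])
        (by rw [Finset.card_pair hvp]; rfl) (by simp [hp]))
      (hC.hasCover_sdiff hk hNx (by omega) fun x hx => Or.inl hx)
      (hC.hasCover_sdiff hk hsub (by omega) ?_) fun K b hK hb => ?_
    · intro u hu
      rcases Finset.mem_insert.1 hu with rfl | hu
      exacts [Or.inr hpU, Or.inl (hqU hu)]
    · have := prob_le_of_term P hb (by omega) (.del3 r h5 h7 (by omega : _ ≤ K))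
      simpa [hd', hdx', hU, sub_sub] using this
  by_cases hxC : x ∈ C
  · have hyC : y ∉ C := fun h => h2 z (by simp [hN, Finset.insert_subset_iff, h, hxC])
    have hzC : z ∉ C := fun h => h2 y (by simp [hN, Finset.insert_subset_iff, h, hxC])
    have hsub : U ⊆ C := hsubU hxC (hC.nbr_subset hyA hyC) (hC.nbr_subset hzA hzC)
    have hcC := Finset.card_le_card hsub
    have hvx : v ≠ x := fun h => notMem_nbr_self (h ▸ hx)
    have hpair : ({v, x} : Finset V) ⊆ C := by simp [Finset.insert_subset_iff, h1, hxC]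
    have hvNx := mem_nbr_comm hv hx
    -- With `v` and `x` in the cover, each of the first two branches isolates one of them and
    -- deletes the other. In the third, all of `U` lies in the cover.
    refine .of_three 2 2 (r + 1)
      (hC.hasCover_sdiff hk hpair (by rw [Finset.card_pair hvx]; rfl) (by simp [hx]))
      (hC.hasCover_sdiff hk hpair (by rw [Finset.card_pair hvx]; rfl) (by simp [hvNx]))
      (hC.hasCover_sdiff hk hsub (by omega) fun x hx => Or.inl hx) fun K b hK hb => ?_
    have := prob_le_of_term P hb (by omega) (.del4 r h5 h7 (by omega : _ ≤ K))
    simpa [hd', hdx', hU, sub_sub] using this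
  by_cases hyC : y ∈ C
  · have hzC : z ∉ C := fun h => h2 x (by simp [hN, Finset.insert_subset_iff, h, hyC])
    exact hone y z hy hz hxC hyC hzC hyU hzU (by omega)
  by_cases hzC : z ∈ C
  · exact hone z y hz hy hxC hzC hyC hzU hyU (by omega)
  have hNx := hC.nbr_subset hxA hxC
  have hsub := Finset.union_subset (hC.nbr_subset hyA hyC) (hC.nbr_subset hzA hzC)
  have hcC := Finset.card_le_card hsub
  -- No neighbour of `v` is in the cover: the first branch only isolates `v`, and the third deletes
  -- `r` cover vertices besides `x`.
  refine .of_three 1 4 r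
    (hC.hasCover_sdiff (T := {v}) hk (by simpa) (by simp) (by simp))
    (hC.hasCover_sdiff hk hNx (by omega) fun x hx => Or.inl hx)
    (hC.hasCover_sdiff hk hsub le_rfl fun x hx => Or.inl (Finset.union_subset hyU hzU hx))
    fun K b hK hb => ?_
  have := prob_le_of_term P hb (by omega) (.del2 r h5 h7 (by omega : _ ≤ K))
  simpa [hd', hdx', hU, sub_sub] using this

theorem Step.branch_bound {n : ℕ} {w : Fin n → ℝ} {U : Fin n → Finset V} {k : ℤ}
    (hs : Step P G A (.branch n w U)) (hC : HasCover G A k) : BranchBound P G A k n w U := by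
  cases hs with
  | degHigh v hA hv h5 hD => exact branchBound_degHigh hA hv h5 hD hC
  | degVeryHigh v U hA hv _ _ hU hc => exact branchBound_degVeryHigh hA hv hU hc hC
  | twoOther v x y hA hv hd hN _ hsq => exact branchBound_twoOther hA hv hd hN hsq hC
  | threeTriangle v x y z hA hv hd hN hxy => exact branchBound_threeTriangle hA hv hd hN hxy hC
  | threeCommon v x y z w hA hv hd hN _ hw _ hwv hxw hyw =>
    exact branchBound_threeCommon hv hd hN hw hwv hxw hyw hC
  | threeFour v x y z hA hv hd hN ht hc hdx => exact branchBound_threeFour hA hv hd hN ht hc hdx hC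

end Steps

/-! ### Existence of runs -/

section Existence

set_option linter.unusedSectionVars false

variable {V : Type*} [DecidableEq V] {P : Params} {G : SimpleGraph V} [DecidableRel G.Adj]
  {A : Finset V}

theorem IsComponent.subset {C : Finset V} (h : IsComponent G A C) : C ⊆ A := by
  obtain ⟨c, hc⟩ := h
  intro v hv
  obtain ⟨u, -, rfl⟩ : v ∈ Subtype.val '' c.supp := hc ▸ Finset.mem_coe.2 hv
  exact u.2

theorem IsComponent.nonempty {C : Finset V} (h : IsComponent G A C) : C.Nonempty := by
  obtain ⟨c, hc⟩ := h
  obtain ⟨v, hv⟩ := c.nonempty_supp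
  exact ⟨v, Finset.mem_coe.1 (hc ▸ Set.mem_image_of_mem _ hv)⟩

theorem IsComponent.mem_of_adj {C : Finset V} (h : IsComponent G A C) {u v : V} (hu : u ∈ C)
    (hv : v ∈ A) (huv : G.Adj u v) : v ∈ C := by
  obtain ⟨c, hc⟩ := h
  obtain ⟨u, huc, rfl⟩ : u ∈ Subtype.val '' c.supp := hc ▸ Finset.mem_coe.2 hu
  have hadj : (G.induce (A : Set V)).Adj u ⟨v, hv⟩ := huv
  have : (⟨v, hv⟩ : (A : Set V)) ∈ c.supp := (c.mem_supp_congr_adj hadj).1 huc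
  exact Finset.mem_coe.1 (hc ▸ Set.mem_image_of_mem _ this)

theorem exists_isComponent (hA : A.Nonempty) : ∃ C, IsComponent G A C := by
  classical
  obtain ⟨v, hv⟩ := hA
  let c := (G.induce (A : Set V)).connectedComponentMk ⟨v, hv⟩
  have hfin : (Subtype.val '' c.supp).Finite :=
    A.finite_toSet.subset (by rintro _ ⟨u, -, rfl⟩; exact u.2)
  exact ⟨hfin.toFinset, c, by simp⟩

/-- Together with `IsComponent.nonempty`, this makes both calls of a split strictly smaller. -/
theorem IsComponent.ne_of_not_connected {C : Finset V} (h : IsComponent G A C)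
    (hA : ¬ (G.induce (A : Set V)).Connected) : C ≠ A := by
  rintro rfl
  obtain ⟨v, hv⟩ := h.nonempty
  obtain ⟨c, hc⟩ := h
  refine hA ((SimpleGraph.connected_iff _).2 ⟨fun a b => ?_, ⟨⟨v, hv⟩⟩⟩)
  have key : ∀ a : (C : Set V), a ∈ c.supp := fun a => by
    obtain ⟨a', ha', h'⟩ : (a : V) ∈ Subtype.val '' c.supp := hc ▸ a.2
    rwa [← Subtype.ext h']
  exact SimpleGraph.ConnectedComponent.exact
    ((SimpleGraph.ConnectedComponent.mem_supp_iff _ _).1 (key a) |>.trans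
      ((SimpleGraph.ConnectedComponent.mem_supp_iff _ _).1 (key b)).symm)

theorem pair_mem_stdSimplex {a : ℝ} (h : 0 ≤ a ∧ 0 ≤ 1 - a) :
    ![a, 1 - a] ∈ stdSimplex ℝ (Fin 2) :=
  ⟨Fin.forall_fin_two.2 h, by simp [Fin.sum_univ_two]⟩

theorem sdiff_ssubset_of_mem {U : Finset V} {u : V} (hA : u ∈ A) (hU : u ∈ U) : A \ U ⊂ A :=
  (Finset.ssubset_iff_of_subset Finset.sdiff_subset).2
    ⟨u, hA, fun h => (Finset.mem_sdiff.1 h).2 hU⟩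

theorem sdiff_nbr_ssubset {U : Finset V} {v : V} (hd : 1 ≤ deg G A v) (hU : nbr G A v ⊆ U) :
    A \ U ⊂ A := by
  obtain ⟨u, hu⟩ := Finset.card_pos.1 hd
  exact sdiff_ssubset_of_mem (nbr_subset hu) (hU hu)

theorem Step.select_ssubset {U : Finset V} (hs : Step P G A (.select U)) : A \ U ⊂ A := by
  cases hs with
  | degOne v u hA hv hN =>
    have hu : u ∈ nbr G A v := by simp [hN]
    exact sdiff_ssubset_of_mem (nbr_subset hu) (Finset.mem_singleton_self u)
  | twoTriangle v x y hA hv hd hN => exact sdiff_nbr_ssubset (by omega) hN.subset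
  | twoSquare v x y z hA hv hd hN => exact sdiff_ssubset_of_mem hv (by simp)

/-- The weights of a branching are probabilities. -/
theorem Step.branch_mem_stdSimplex {n : ℕ} {w : Fin n → ℝ} {U : Fin n → Finset V}
    (hs : Step P G A (.branch n w U)) : w ∈ stdSimplex ℝ (Fin n) := by
  cases hs with
  | degHigh v hA hv h5 hD => exact pair_mem_stdSimplex (P.gam_bounds h5 hD.le)
  | degVeryHigh => exact pair_mem_stdSimplex (P.gam_bounds P.five_le_Delta le_rfl)
  | twoOther v x y hA hv hd hN _ hsq =>
    have hr := card_union_of_not_square hA hv hN hsq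
    exact pair_mem_stdSimplex (P.lam1_bounds hr.1 hr.2)
  | threeTriangle v x y z hA hv hd hN hxy =>
    have hr := hA.deg_bounds (nbr_subset (G := G) (v := v) (show z ∈ _ by simp [hN]))
    exact pair_mem_stdSimplex (P.lam2_bounds hr.1 hr.2)
  | threeCommon => exact pair_mem_stdSimplex P.lam3_bounds
  | threeFour v x y z hA hv hd hN ht hc hdx =>
    have hy : y ∈ nbr G A v := by simp [hN]
    have hz : z ∈ nbr G A v := by simp [hN]
    have hr := card_union_nbr ht hc hv hy hz (ne_of_card_three hd hN).2.2
    have hdy := hA.deg_bounds (nbr_subset hy)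
    have hdz := hA.deg_bounds (nbr_subset hz)
    have h5 : 5 ≤ (nbr G A y ∪ nbr G A z).card := by omega
    have h7 : (nbr G A y ∪ nbr G A z).card ≤ 7 := by omega
    refine ⟨fun i => ?_, ?_⟩
    · fin_cases i
      exacts [P.del1_nonneg _ h5 h7, P.del2_nonneg _ h5 h7, P.del3_nonneg _ h5 h7]
    · simpa [Fin.sum_univ_three] using P.del_sum _ h5 h7

/-- Termination: each branch contains a vertex of `A` because the neighbourhoods involved are
nonempty. -/
theorem Step.branch_ssubset {n : ℕ} {w : Fin n → ℝ} {U : Fin n → Finset V}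
    (hs : Step P G A (.branch n w U)) (i : Fin n) : A \ U i ⊂ A := by
  cases hs with
  | degHigh v hA hv h5 hD =>
    fin_cases i
    · exact sdiff_ssubset_of_mem hv (Finset.mem_singleton_self v)
    · exact sdiff_nbr_ssubset (by omega) Finset.Subset.rfl
  | degVeryHigh v U hA hv h5 _ hU hc =>
    fin_cases i
    · exact sdiff_ssubset_of_mem hv (Finset.mem_singleton_self v)
    · obtain ⟨u, hu⟩ := Finset.card_pos.1 (show 0 < U.card by have := P.five_le_Delta; omega)
      exact sdiff_ssubset_of_mem (nbr_subset (hU hu)) hu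
  | twoOther v x y hA hv hd hN _ hsq =>
    fin_cases i
    · exact sdiff_nbr_ssubset (by omega) Finset.Subset.rfl
    · refine sdiff_nbr_ssubset (v := x) ?_ Finset.subset_union_left
      have := hA.1.deg_bounds (nbr_subset (G := G) (v := v) (show x ∈ _ by simp [hN]))
      omega
  | threeTriangle v x y z hA hv hd hN hxy =>
    fin_cases i
    · exact sdiff_nbr_ssubset (by omega) Finset.Subset.rfl
    · refine sdiff_nbr_ssubset (v := z) ?_ Finset.Subset.rfl
      have := hA.deg_bounds (nbr_subset (G := G) (v := v) (show z ∈ _ by simp [hN]))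
      omega
  | threeCommon v x y z w hA hv hd hN =>
    fin_cases i
    · exact sdiff_nbr_ssubset (by omega) Finset.Subset.rfl
    · exact sdiff_ssubset_of_mem hv (Finset.mem_insert_self v {w})
  | threeFour v x y z hA hv hd hN ht hc hdx =>
    have hx : x ∈ A := nbr_subset (G := G) (v := v) (by simp [hN])
    fin_cases i
    · exact sdiff_nbr_ssubset (by omega) Finset.Subset.rfl
    · exact sdiff_nbr_ssubset (v := x) (by omega) Finset.Subset.rfl
    · exact sdiff_ssubset_of_mem hx (by simp)

/-- Some vertex of degree three has a neighbour of degree four. -/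
theorem PastDegTwo.exists_three_four (hA : PastDegTwo G A) :
    ∃ v ∈ A, deg G A v = 3 ∧ ∃ x ∈ nbr G A v, deg G A x = 4 := by
  by_contra hne
  push Not at hne
  obtain ⟨u, hu, -⟩ := exists_adj_of_not_trivial hA.1.1.1.1.1
  -- Without an edge joining degrees 3 and 4, the degree is constant along edges, so connectedness
  -- makes the graph regular.
  refine hA.1.2 ⟨deg G A u, forall_of_connected hA.1.1.1.1.2 hu rfl fun a ha b hb hab he => ?_⟩
  have h1 := hA.deg_bounds ha
  have h2 := hA.deg_bounds hb
  have h3 := hne a ha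
  have h4 := hne b hb
  by_cases ha3 : deg G A a = 3
  · have := h3 ha3 b (mem_nbr.2 ⟨hb, hab⟩)
    omega
  · by_cases hb3 : deg G A b = 3
    · have := h4 hb3 a (mem_nbr.2 ⟨ha, hab.symm⟩)
      omega
    · omega

/-- Two elements of a set of size three can be listed first. -/
theorem exists_eq_triple {N : Finset V} (hN : N.card = 3) {x y : V} (hx : x ∈ N) (hy : y ∈ N)
    (hxy : x ≠ y) : ∃ z, N = {x, y, z} := by
  have hy' : y ∈ N.erase x := Finset.mem_erase.2 ⟨hxy.symm, hy⟩
  have : ((N.erase x).erase y).card = 1 := by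
    rw [Finset.card_erase_of_mem hy', Finset.card_erase_of_mem hx, hN]
  obtain ⟨z, hz⟩ := Finset.card_eq_one.1 this
  exact ⟨z, by rw [← hz, Finset.insert_erase hy', Finset.insert_erase hx]⟩

variable (P G) in
/-- Some instruction of the algorithm always applies. -/
theorem exists_step (A : Finset V) : ∃ a, Step P G A a := by
  by_cases h1 : Trivial G A
  · exact ⟨_, .empty h1⟩
  obtain ⟨a, ha, b, hb, hab⟩ := exists_adj_of_not_trivial h1
  by_cases h2 : (G.induce (A : Set V)).Connected
  swap
  · obtain ⟨C, hC⟩ := exists_isComponent (G := G) ⟨a, ha⟩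
    exact ⟨_, .split C h1 h2 hC⟩
  by_cases h3 : ∃ v ∈ A, deg G A v = 1
  · obtain ⟨v, hv, hd⟩ := h3
    obtain ⟨u, hu⟩ := Finset.card_eq_one.1 hd
    exact ⟨_, .degOne v u ⟨h1, h2⟩ hv hu⟩
  push Not at h3
  have p3 : PastDegOne G A := ⟨⟨h1, h2⟩, h3⟩
  by_cases h4 : ∃ v ∈ A, 5 ≤ deg G A v
  · obtain ⟨v, hv, hd⟩ := h4
    by_cases hD : deg G A v < P.Delta
    · exact ⟨_, .degHigh v p3 hv hd hD⟩
    · obtain ⟨U, hU, hc⟩ := Finset.exists_subset_card_eq (not_lt.1 hD)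
      exact ⟨_, .degVeryHigh v U p3 hv hd (not_lt.1 hD) hU hc⟩
  push Not at h4
  have p4 : PastHighDeg G A := ⟨p3, fun v hv => not_le.2 (h4 v hv)⟩
  by_cases h5 : Regular G A
  · exact ⟨_, .regular a b p4 h5 ha hb hab⟩
  have p5 : PastRegular G A := ⟨p4, h5⟩
  by_cases h6 : ∃ v ∈ A, deg G A v = 2
  · obtain ⟨v, hv, hd⟩ := h6
    obtain ⟨x, y, -, hN⟩ := Finset.card_eq_two.1 hd
    by_cases hxy : G.Adj x y
    · exact ⟨_, .twoTriangle v x y p5 hv hd hN hxy⟩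
    by_cases hsq : ∃ z, Square G A v x y z
    · obtain ⟨z, hz⟩ := hsq
      exact ⟨_, .twoSquare v x y z p5 hv hd hN hxy hz⟩
    · exact ⟨_, .twoOther v x y p5 hv hd hN hxy fun z hz => hsq ⟨z, hz⟩⟩
  push Not at h6
  have p6 : PastDegTwo G A := ⟨p5, h6⟩
  -- Choosing `v` with a neighbour of degree four ensures that the last case is available when the
  -- two before it fail at `v`.
  obtain ⟨v, hv, hd, x, hx, hdx⟩ := p6.exists_three_four
  by_cases ht : HasTriangle G A v
  · obtain ⟨x, hx, y, hy, hxy⟩ := ht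
    obtain ⟨z, hN⟩ := exists_eq_triple hd hx hy hxy.ne
    exact ⟨_, .threeTriangle v x y z p6 hv hd hN hxy⟩
  by_cases hc : HasCommon G A v
  · obtain ⟨x, hx, y, hy, hxy, w, hw, hwN, hwv, hxw, hyw⟩ := hc
    obtain ⟨z, hN⟩ := exists_eq_triple hd hx hy hxy
    exact ⟨_, .threeCommon v x y z w p6 hv hd hN ht hw hwN hwv hxw hyw⟩
  obtain ⟨y, hy, hyx⟩ := Finset.exists_mem_ne (show 1 < (nbr G A v).card by
    unfold deg at hd; omega) x
  obtain ⟨z, hN⟩ := exists_eq_triple hd hx hy hyx.symm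
  exact ⟨_, .threeFour v x y z p6 hv hd hN ht hc hdx⟩

variable (P G) in
/-- The algorithm runs to completion on every induced subgraph. -/
theorem exists_run (A : Finset V) : ∃ μ, Run P G A μ := by
  induction A using Finset.strongInduction with
  | H A ih =>
    obtain ⟨a, ha⟩ := exists_step P G A
    cases a with
    | done => exact ⟨_, .done ha⟩
    | split B C =>
      have hsub : B ⊂ A ∧ C ⊂ A := by
        cases ha with
        | split C _ hc hC =>
          refine ⟨hC.subset.ssubset_of_ne (hC.ne_of_not_connected hc), ?_⟩
          obtain ⟨v, hv⟩ := hC.nonempty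
          exact sdiff_ssubset_of_mem (hC.subset hv) hv
      obtain ⟨μ, hμ⟩ := ih B hsub.1
      obtain ⟨ν, hν⟩ := ih C hsub.2
      exact ⟨_, .split ha hμ hν⟩
    | select U =>
      obtain ⟨μ, hμ⟩ := ih _ ha.select_ssubset
      exact ⟨_, .select ha hμ⟩
    | branch n w U =>
      choose μ hμ using fun i => ih _ (ha.branch_ssubset i)
      exact ⟨_, .branch ha.branch_mem_stdSimplex μ ha hμ⟩
    | best v₁ v₂ =>
      have hmem : v₁ ∈ A ∧ v₂ ∈ A := by
        cases ha with
        | regular _ _ _ _ h1 h2 => exact ⟨h1, h2⟩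
      obtain ⟨μ, hμ⟩ := ih _ (sdiff_ssubset_of_mem hmem.1 (Finset.mem_singleton_self v₁))
      obtain ⟨ν, hν⟩ := ih _ (sdiff_ssubset_of_mem hmem.2 (Finset.mem_singleton_self v₂))
      exact ⟨_, .best ha hμ hν⟩

end Existence

/-! ### Correctness of runs -/

section Correctness

set_option linter.unusedSectionVars false

variable {V : Type*} [DecidableEq V] {P : Params} {G : SimpleGraph V} [DecidableRel G.Adj]
  {A : Finset V}

theorem Covers.union_of_sdiff {S U : Finset V} (h : Covers G (A \ U) S) : Covers G A (S ∪ U) := by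
  intro u hu v hv huv
  by_cases h1 : u ∈ U
  · exact Or.inl (Finset.mem_union_right _ h1)
  by_cases h2 : v ∈ U
  · exact Or.inr (Finset.mem_union_right _ h2)
  exact (h u (Finset.mem_sdiff.2 ⟨hu, h1⟩) v (Finset.mem_sdiff.2 ⟨hv, h2⟩) huv).imp
    (Finset.mem_union_left _) (Finset.mem_union_left _)

/-- Every possible output is a vertex cover. -/
theorem Run.covers {μ : PMF (Finset V)} (h : Run P G A μ) : ∀ S ∈ μ.support, Covers G A S := by
  induction h with
  | done hs =>
    intro S hS
    cases hs with
    | empty ht =>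
      intro u hu v hv huv
      simpa using ht (v := ⟨u, hu⟩) (w := ⟨v, hv⟩) huv
  | @split A B C μ ν hs _ _ ihB ihC =>
    intro R hR
    simp only [PMF.mem_support_bind_iff, PMF.mem_support_map_iff] at hR
    obtain ⟨S, hS, T, hT, rfl⟩ := hR
    have h1 := ihB S hS
    have h2 := ihC T hT
    cases hs with
    | split _ _ _ hC =>
      intro u hu v hv huv
      by_cases hu' : u ∈ B
      · exact (h1 u hu' v (hC.mem_of_adj hu' hv huv) huv).imp
          (Finset.mem_union_left _) (Finset.mem_union_left _)
      · have hv' : v ∉ B := fun h => hu' (hC.mem_of_adj h hu huv.symm)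
        exact (h2 u (Finset.mem_sdiff.2 ⟨hu, hu'⟩) v (Finset.mem_sdiff.2 ⟨hv, hv'⟩) huv).imp
          (Finset.mem_union_right _) (Finset.mem_union_right _)
  | select _ _ ih =>
    intro R hR
    obtain ⟨S, hS, rfl⟩ := (PMF.mem_support_map_iff _ _ _).1 hR
    exact (ih S hS).union_of_sdiff
  | branch _ μ _ _ ih =>
    intro R hR
    simp only [PMF.mem_support_bind_iff, PMF.mem_support_map_iff] at hR
    obtain ⟨i, -, S, hS, rfl⟩ := hR
    exact (ih i S hS).union_of_sdiff
  | best _ _ _ ih₁ ih₂ =>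
    intro R hR
    simp only [PMF.mem_support_bind_iff, PMF.mem_support_map_iff] at hR
    obtain ⟨S, hS, T, hT, rfl⟩ := hR
    split_ifs
    · exact (ih₁ S hS).union_of_sdiff
    · exact (ih₂ T hT).union_of_sdiff

variable [Fintype V]

/-- Adding `U` to the output costs at most the size of `U`. -/
theorem expect_prob_le_union (μ : PMF (Finset V)) (U : Finset V) (m b : ℤ) :
    (expect μ fun S => prob P (b - U.card - S.card) m) ≤
      expect μ fun S => prob P (b - (S ∪ U).card) m := by
  refine expect_mono fun S => prob_mono P ?_ le_rfl
  have := Finset.card_union_le S U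
  omega

/-- The main estimate. The additional parameter `m` stands for the size of a cover of the parts
of the graph that are treated afterwards. -/
theorem Run.prob_le_expect {μ : PMF (Finset V)} (h : Run P G A μ) :
    ∀ k m b : ℤ, HasCover G A k → 0 ≤ m →
      prob P b (k + m) ≤ expect μ fun S => prob P (b - S.card) m := by
  -- The recurrence holds only for a nonnegative budget; for a negative one the left side vanishes.
  have of_nonneg : ∀ {μ : PMF (Finset V)} {K m b : ℤ},
      (0 ≤ b → prob P b K ≤ expect μ fun S => prob P (b - S.card) m) →
      prob P b K ≤ expect μ fun S => prob P (b - S.card) m := by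
    intro μ K m b h
    by_cases hb : b < 0
    · rw [prob_of_neg P hb]
      exact expect_nonneg fun S => prob_nonneg P _ _
    · exact h (not_lt.1 hb)
  induction h with
  | done _ =>
    intro k m b hC hm
    have := hC.nonneg
    rw [expect_pure]
    exact prob_mono P (by simp) (by omega)
  | @split A B C μ ν hs _ _ ihB ihC =>
    intro k m b ⟨D, hD, hk⟩ hm
    cases hs with
    | split _ _ _ hB =>
      have hcard := Finset.card_inter_add_card_sdiff D B
      have hcovB : HasCover G B (D ∩ B).card := by
        refine ⟨_, fun u hu v hv huv => ?_, le_rfl⟩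
        exact (hD u (hB.subset hu) v (hB.subset hv) huv).imp
          (fun h => Finset.mem_inter.2 ⟨h, hu⟩) fun h => Finset.mem_inter.2 ⟨h, hv⟩
      have hcovC : HasCover G (A \ B) (k - (D ∩ B).card) := by
        refine ⟨D \ B, fun u hu v hv huv => ?_, by omega⟩
        rw [Finset.mem_sdiff] at hu hv
        exact (hD u hu.1 v hv.1 huv).imp
          (fun h => Finset.mem_sdiff.2 ⟨h, hu.2⟩) fun h => Finset.mem_sdiff.2 ⟨h, hv.2⟩
      have hnn := hcovC.nonneg
      -- The reserve for the first component includes the cover size of the rest, which the second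
      -- call then uses up.
      have h1 := ihB _ (k - (D ∩ B).card + m) b hcovB (by omega)
      rw [show ((D ∩ B).card : ℤ) + (k - (D ∩ B).card + m) = k + m by ring] at h1
      refine h1.trans ?_
      rw [expect_bind]
      refine expect_mono fun S => ?_
      rw [expect_map]
      refine (ihC _ m (b - S.card) hcovC hm).trans (expect_mono fun T => prob_mono P ?_ le_rfl)
      have := Finset.card_union_le S T
      omega
  | @select A U μ hs _ ih =>
    intro k m b hC hm
    refine of_nonneg fun hb => ?_
    obtain ⟨h1, h2⟩ := hs.select_bound hC
    rw [expect_map]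
    refine ((h2 (k + m) b (by omega) hb).trans ?_).trans (expect_prob_le_union _ U _ _)
    rw [add_sub_right_comm]
    exact ih _ _ _ h1 hm
  | @branch A n w U hw μ hs _ ih =>
    intro k m b hC hm
    refine of_nonneg fun hb => ?_
    obtain ⟨κ, h1, h2⟩ := hs.branch_bound hC
    rw [expect_bind, expect_choose]
    refine (h2 m b hm hb).trans (Finset.sum_le_sum fun i _ => ?_)
    refine mul_le_mul_of_nonneg_left ?_ (hw.1 i)
    rw [expect_map]
    exact (ih i _ _ _ (h1 i) hm).trans (expect_prob_le_union _ (U i) _ _)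
  | @best A v₁ v₂ μ ν hs _ _ ih₁ ih₂ =>
    intro k m b hC hm
    refine of_nonneg fun hb => ?_
    obtain ⟨h1, h2⟩ := hs.best_bound hC
    rw [expect_bind]
    simp only [expect_map]
    refine (h2 (k + m) b (by omega) hb).trans ?_
    rw [add_sub_right_comm]
    -- Only the call whose deleted vertex lies in the good cover is analysed. The returned set is no
    -- larger than that call's candidate, whatever the other call produces, so the other expectation
    -- is of a constant.
    rcases h1 with h1 | h1
    · refine (ih₁ _ _ _ h1 hm).trans (expect_mono fun S => ?_)
      rw [← expect_const ν (prob P (b - 1 - S.card) m)]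
      refine expect_mono fun T => prob_mono P ?_ le_rfl
      have := Finset.card_union_le S {v₁}
      rw [Finset.card_singleton] at this
      split_ifs <;> omega
    · rw [expect_comm]
      refine (ih₂ _ _ _ h1 hm).trans (expect_mono fun T => ?_)
      rw [← expect_const μ (prob P (b - 1 - T.card) m)]
      refine expect_mono fun S => prob_mono P ?_ le_rfl
      have := Finset.card_union_le T {v₂}
      rw [Finset.card_singleton] at this
      split_ifs <;> omega

end Correctness

end BetterVC

theorem mainTheorem5 {V : Type*} [Fintype V] [DecidableEq V] (G : SimpleGraph V)
    [DecidableRel G.Adj] (P : BetterVC.Params) (k : ℕ)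
    (hG : ∃ S : Finset V, G.IsVertexCover (S : Set V) ∧ S.card ≤ k) (b : ℤ) :
    (∃ μ : PMF (Finset V), BetterVC.Run P G Finset.univ μ) ∧
    ∀ μ : PMF (Finset V), BetterVC.Run P G Finset.univ μ →
      BetterVC.prob P b k ≤
        (μ.toOuterMeasure {S | G.IsVertexCover (S : Set V) ∧ (S.card : ℤ) ≤ b}).toReal := by
  refine ⟨BetterVC.exists_run P G _, fun μ hμ => ?_⟩
  obtain ⟨C, hC, hk⟩ := hG
  have hcov : BetterVC.HasCover G Finset.univ k :=
    ⟨C, fun u _ v _ huv => hC huv, by exact_mod_cast hk⟩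
  have hmain := hμ.prob_le_expect k 0 b hcov le_rfl
  rw [add_zero] at hmain
  refine hmain.trans (BetterVC.expect_le_toOuterMeasure
    (fun S => BetterVC.prob_le_one P _ _) fun S hS hn => ?_)
  have hlt : b < S.card := by
    by_contra hle
    exact hn ⟨fun u v huv => hμ.covers S hS u (Finset.mem_univ u) v (Finset.mem_univ v) huv,
      not_lt.1 hle⟩
  -- Outputs are always covers, so failure means exceeding the budget, and p vanishes at a negative
  -- budget.
  exact (BetterVC.prob_of_neg P (by omega) 0).le
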